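/- **Relative entropy identity.** Work on the torus $\mathbb T^3=\mathbb R^3/\mathbb Z^3$, with summation over repeated indices $i,\alpha\in\{1,2,3\}$, $A,B\in\{1,\dots,19\}$. For $F\in\mathbb R^{3\times3}$ let $\Phi(F)=(F,\operatorname{cof}F,\det F)\in\mathbb R^{19}$, write $\xi=(F,Z,w)\in\mathbb R^{19}$, $\Phi^A_{,i\alpha}=\partial\Phi^A/\partial F_{i\alpha}$, $G_{,A}=\partial G/\partial\xi_A$, $G_{,AB}=\partial^2G/\partial\xi_A\partial\xi_B$. Let $G\in C^2(\mathbb R^{19})$ (in particular, $G$ may be the convex function representing a polyconvex stored energy $W=G\circ\Phi$), and let $\eta(v,\xi)=\frac12|v|^2+G(\xi)$. *Scheme.* Let $\mathcal T_h$ be a partition of $\mathbb T^3$ into finitely many convex polytopes with non-empty, pairwise disjoint interiors, and let $k\ge1$. Let $U_h$ be the space of continuous $\mathbb R^3$-valued fields on $\mathbb T^3$ which are polynomials of degree $\le k$ on each $K\in\mathcal T_h$, and let $H_h$ be the space of fields $\psi=(\psi^F,\psi^Z,\psi^w)\in L^2(\mathbb T^3;\mathbb R^{19})$ whose components are, on each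 $K$, polynomials of degree $\le k-1$ (for $\psi^F$), $\le 2(k-1)$ (for $\psi^Z$), $\le 3(k-1)$ (for $\psi^w$). Let $\mathbb P^U$ be the $L^2$-orthogonal projection onto $U_h$. Let $\tau>0$ and let $(v^n,\xi^n)\in U_h\times H_h$, $n\ge0$, $\xi^n=(F^n,Z^n,w^n)$, satisfy for all $n\ge1$ $$\int_{\mathbb T^3}\frac{v^n_i-v^{n-1}_i}{\tau}\varphi_i\,dx=-\int_{\mathbb T^3}G_{,A}(\xi^n)\Phi^A_{,i\alpha}(F^{n-1})\,\partial_\alpha\varphi_i\,dx\quad\forall\varphi\in U_h,$$ $$\int_{\mathbb T^3}\frac{\xi^n_A-\xi^{n-1}_A}{\tau}\psi_A\,dx=\int_{\mathbb T^3}\Phi^A_{,i\alpha}(F^{n-1})\,\partial_\alpha v^n_i\,\psi_A\,dx\quad\forall\psi\in H_h .$$ For $t\in[(n-1)\tau,n\tau)$, $n\ge1$, with $\Theta^n=(v^n,\xi^n)$, put $\delta\Theta=\Theta^n-\Theta^{n-1}$, $$\widehat\Theta=(\widehat v,\widehat\xi)=\Theta^{n-1}+\tfrac{t-\tau(n-1)}{\tau}\,\delta\Theta,\qquad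 \bar\Theta=(\bar v,\bar\xi)=\Theta^n,\qquad \bar F_*=F^{n-1},$$ and let $\widehat F$ be the $F$-component of $\widehat\xi$. *Exact solution.* Let $T>0$ and let $\Theta=(v,\xi)$, $\xi=(F,Z,w)$, be a solution, continuously differentiable on $\mathbb T^3\times[0,T]$, of $$\partial_tv_i=\partial_\alpha\big(G_{,A}(\xi)\Phi^A_{,i\alpha}(F)\big),\qquad \partial_t\xi_A=\partial_\alpha\big(\Phi^A_{,i\alpha}(F)v_i\big).$$ Assume that $F^0$ and $F(\cdot,0)$ are gradients, i.e. each equals $\nabla y$ (weakly) for some $y:\mathbb R^3\to\mathbb R^3$. *Claim.* Let $\eta^r=\eta(\widehat\Theta)-\eta(\Theta)-D\eta(\Theta)(\widehat\Theta-\Theta)$. Then for a.e. $t\in[0,T]$ the function $\eta^r(x,\cdot)$ is differentiable at $t$ for every $x$, both integrands below are integrable over $\mathbb T^3$, and $$\int_{\mathbb T^3}\partial_t\eta^r\,dx=\int_{\mathbb T^3}\Big(-\frac1\tau D+Q+E+\bar E\Big)dx,$$ where $D=(\nabla\eta(\bar\Theta)-\nabla\eta(\widehat\Theta))\cdot\delta\Theta$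 (the dissipation), $$\begin{aligned}Q={}&\partial_\alpha(G_{,A}(\xi))\big(\Phi^A_{,i\alpha}(\widehat F)-\Phi^A_{,i\alpha}(F)\big)(\widehat v_i-v_i)+\partial_\alpha v_i\big(G_{,A}(\widehat\xi)-G_{,A}(\xi)\big)\big(\Phi^A_{,i\alpha}(\widehat F)-\Phi^A_{,i\alpha}(F)\big)\\&+\partial_\alpha v_i\big(G_{,A}(\widehat\xi)-G_{,A}(\xi)-G_{,AB}(\xi)(\widehat\xi-\xi)_B\big)\Phi^A_{,i\alpha}(F),\end{aligned}$$ $$\begin{aligned}E={}&\partial_\alpha(G_{,A}(\xi))\Big[\Phi^A_{,i\alpha}(F)(\bar v_i-\widehat v_i)+\big(\Phi^A_{,i\alpha}(\widehat F)-\Phi^A_{,i\alpha}(F)\big)(\bar v_i-\widehat v_i)\\&\quad+\big(\Phi^A_{,i\alpha}(\bar F_*)-\Phi^A_{,i\alpha}(\widehat F)\big)(\bar v_i-\widehat v_i)+\big(\Phi^A_{,i\alpha}(\bar F_*)-\Phi^A_{,i\alpha}(\widehat F)\big)(\widehat v_i-v_i)\Big]\\&+\partial_\alpha v_i\Big[\big(G_{,A}(\bar\xi)-G_{,A}(\widehat\xi)\big)\Phi^A_{,i\alpha}(F)+\big(G_{,A}(\bar\xi)-G_{,A}(\widehat\xi)\big)\big(\Phi^A_{,i\alpha}(\bar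 F_*)-\Phi^A_{,i\alpha}(\widehat F)\big)\\&\quad+\big(G_{,A}(\bar\xi)-G_{,A}(\widehat\xi)\big)\big(\Phi^A_{,i\alpha}(\widehat F)-\Phi^A_{,i\alpha}(F)\big)+\big(G_{,A}(\widehat\xi)-G_{,A}(\xi)\big)\big(\Phi^A_{,i\alpha}(\bar F_*)-\Phi^A_{,i\alpha}(\widehat F)\big)\Big]\end{aligned}$$ (the time-discretization error), and $\bar E=G_{,A}(\bar\xi)\,\Phi^A_{,i\alpha}(\bar F_*)\,\partial_\alpha\big((\mathbb P^Uv)_i-v_i\big)$ (the spatial-discretization error). -/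

import Mathlib

open MeasureTheory Set

namespace Elasto

noncomputable section

/-! ## Periodic functions on `ℝ³` (functions on the torus `𝕋³ = ℝ³/ℤ³`) -/

/-- Points of `ℝ³`. Only the measure and the derivatives are used, never the norm. -/
abbrev Pt := Fin 3 → ℝ

/-- `3 × 3` real matrices, `F i α`. -/
abbrev Mat3 := Fin 3 → Fin 3 → ℝ

/-- The point of the lattice `ℤ³` with integer coordinates `z`. -/
def lattice (z : Fin 3 → ℤ) : Pt := fun i => (z i : ℝ)

/-- `ℤ³`-periodicity: `f` is a function on the torus `ℝ³/ℤ³`. -/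
def IsPeriodic {β : Type*} (f : Pt → β) : Prop :=
  ∀ (z : Fin 3 → ℤ) (x : Pt), f (x + lattice z) = f x

/-- The unit cell `[0,1]³`; the integral over the torus is the integral over it. -/
def unitCell : Set Pt := Set.Icc 0 1

/-- The partial derivative `∂_α f` of a scalar function on `ℝ³`. -/
def pd (α : Fin 3) (f : Pt → ℝ) (x : Pt) : ℝ := fderiv ℝ f x (Pi.single α 1)

/-- `F` is a gradient: `F_{iα} = ∂_α y_i` for some `y : ℝ³ → ℝ³`, in the sense of weak derivatives.
The map `y` need not be periodic itself (`y(x) = x` on the torus is allowed). -/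
def IsGradient (F : Pt → Mat3) : Prop :=
  LocallyIntegrable F ∧
  ∃ y : Pt → Fin 3 → ℝ, LocallyIntegrable y ∧
    ∀ φ : Pt → ℝ, ContDiff ℝ (⊤ : ℕ∞) φ → HasCompactSupport φ → ∀ i α : Fin 3,
      ∫ x, y x i * pd α φ x = -∫ x, F x i α * φ x

/-! ## The nineteen null Lagrangians -/

/-- The index `A = 1, …, 19` of `ξ = (F, Z, w)`. -/
abbrev Idx := (Fin 3 × Fin 3) ⊕ (Fin 3 × Fin 3) ⊕ Unit

/-- The space `ℝ¹⁹` of the vectors `ξ = (F, Z, w)`. -/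
abbrev Xi := Idx → ℝ

/-- The component `F` of `ξ = (F, Z, w)`. -/
def Fpart (ξ : Xi) : Mat3 := fun i α => ξ (Sum.inl (i, α))

/-- `Φ(F) = (F, cof F, det F)`. -/
def Phi (F : Mat3) : Xi
  | Sum.inl (i, α) => F i α
  | Sum.inr (Sum.inl (i, α)) => (Matrix.of F).adjugate.transpose i α
  | Sum.inr (Sum.inr _) => (Matrix.of F).det

/-- `Φ^A_{,iα}(F) = ∂Φ^A/∂F_{iα} (F)`. -/
def dPhi (A : Idx) (i α : Fin 3) (F : Mat3) : ℝ :=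
  fderiv ℝ (fun F' : Mat3 => Phi F' A) F (Pi.single i (Pi.single α 1))

/-- `G_{,A}(ξ) = ∂G/∂ξ_A (ξ)`. -/
def dG (G : Xi → ℝ) (A : Idx) (ξ : Xi) : ℝ := fderiv ℝ G ξ (Pi.single A 1)

/-- `G_{,AB}(ξ) = ∂²G/∂ξ_A∂ξ_B (ξ)`. -/
def ddG (G : Xi → ℝ) (A B : Idx) (ξ : Xi) : ℝ := dG (dG G A) B ξ

/-! ## Meshes and finite element spaces -/

/-- A mesh of the torus: finitely many closed convex polytopes with non-empty interior (for instance
tetrahedra) whose `ℤ³`-translates cover `ℝ³` and have pairwise disjoint interiors. -/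
structure PeriodicMesh where
  cells : Finset (Set Pt)
  polytope : ∀ K ∈ cells, ∃ s : Finset Pt, K = convexHull ℝ (s : Set Pt)
  interior_nonempty : ∀ K ∈ cells, (interior K).Nonempty
  covers : ∀ x : Pt, ∃ K ∈ cells, ∃ z : Fin 3 → ℤ, x + lattice z ∈ K
  disjoint : ∀ K ∈ cells, ∀ K' ∈ cells, ∀ (z : Fin 3 → ℤ) (x : Pt),
    x ∈ interior K → x + lattice z ∈ interior K' → K = K' ∧ z = 0

/-- `U_h`: continuous vector fields on the torus which are polynomials of total degree at most `k`
on each element. -/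
def Uh (M : PeriodicMesh) (k : ℕ) : Submodule ℝ (Pt → Fin 3 → ℝ) where
  carrier := {φ | Continuous φ ∧ IsPeriodic φ ∧ ∀ K ∈ M.cells, ∀ i, ∃ p : MvPolynomial (Fin 3) ℝ,
    p.totalDegree ≤ k ∧ ∀ x ∈ K, φ x i = MvPolynomial.eval x p}
  zero_mem' := ⟨continuous_const, fun _ _ => rfl, fun _ _ _ => ⟨0, by simp, by simp⟩⟩
  add_mem' := by
    rintro f g ⟨hf, hfp, hfK⟩ ⟨hg, hgp, hgK⟩
    refine ⟨hf.add hg, fun z x => by simp [hfp z x, hgp z x], fun K hK i => ?_⟩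
    obtain ⟨p, hp, hpx⟩ := hfK K hK i
    obtain ⟨q, hq, hqx⟩ := hgK K hK i
    exact ⟨p + q, (MvPolynomial.totalDegree_add p q).trans (max_le hp hq),
      fun x hx => by simp [hpx x hx, hqx x hx]⟩
  smul_mem' := by
    rintro c f ⟨hf, hfp, hfK⟩
    refine ⟨hf.const_smul c, fun z x => by simp [hfp z x], fun K hK i => ?_⟩
    obtain ⟨p, hp, hpx⟩ := hfK K hK i
    exact ⟨c • p, (MvPolynomial.totalDegree_smul_le c p).trans hp,
      fun x hx => by simp [hpx x hx]⟩

/-- The polynomial degrees `k-1`, `2(k-1)`, `3(k-1)` used for the components `F`, `Z`, `w`. -/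
def degH (k : ℕ) : Idx → ℕ
  | Sum.inl _ => k - 1
  | Sum.inr (Sum.inl _) => 2 * (k - 1)
  | Sum.inr (Sum.inr _) => 3 * (k - 1)

/-- `H_h = H^F_h × H^Z_h × H^w_h`: (possibly discontinuous) fields on the torus whose components
agree a.e. on each element with polynomials of degree at most `k-1`, `2(k-1)`, `3(k-1)`. -/
def Hh (M : PeriodicMesh) (k : ℕ) : Submodule ℝ (Pt → Xi) where
  carrier := {ψ | IsPeriodic ψ ∧ ∀ K ∈ M.cells, ∀ A, ∃ p : MvPolynomial (Fin 3) ℝ,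
    p.totalDegree ≤ degH k A ∧ ∀ᵐ x ∂(volume.restrict K), ψ x A = MvPolynomial.eval x p}
  zero_mem' := ⟨fun _ _ => rfl, fun _ _ _ => ⟨0, by simp, by simp⟩⟩
  add_mem' := by
    rintro f g ⟨hfp, hfK⟩ ⟨hgp, hgK⟩
    refine ⟨fun z x => by simp [hfp z x, hgp z x], fun K hK i => ?_⟩
    obtain ⟨p, hp, hpx⟩ := hfK K hK i
    obtain ⟨q, hq, hqx⟩ := hgK K hK i
    refine ⟨p + q, (MvPolynomial.totalDegree_add p q).trans (max_le hp hq), ?_⟩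
    filter_upwards [hpx, hqx] with x h1 h2
    simp [h1, h2]
  smul_mem' := by
    rintro c f ⟨hfp, hfK⟩
    refine ⟨fun z x => by simp [hfp z x], fun K hK i => ?_⟩
    obtain ⟨p, hp, hpx⟩ := hfK K hK i
    refine ⟨c • p, (MvPolynomial.totalDegree_smul_le c p).trans hp, ?_⟩
    filter_upwards [hpx] with x h1
    simp [h1]

/-- `P` is the `L²(𝕋³)`-orthogonal projection of `v` onto `U_h`. -/
def IsL2Proj (M : PeriodicMesh) (k : ℕ) (v P : Pt → Fin 3 → ℝ) : Prop :=
  P ∈ Uh M k ∧ ∀ φ ∈ Uh M k, ∫ x in unitCell, ∑ i, (v x i - P x i) * φ x i = 0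

instance Uh_finite (M : PeriodicMesh) (k : ℕ) : FiniteDimensional ℝ (Uh M k) := by
  let ev : ∀ j : M.cells × Fin 3, MvPolynomial.restrictTotalDegree (Fin 3) ℝ k →ₗ[ℝ] (j.1.1 → ℝ) :=
    fun j =>
    { toFun := fun p x => MvPolynomial.eval x.1 p.1
      map_add' := fun p q => by ext x; simp
      map_smul' := fun c p => by ext x; simp }
  let W := ∀ j : M.cells × Fin 3, LinearMap.range (ev j)
  let r : Uh M k →ₗ[ℝ] W :=
    { toFun := fun φ j => ⟨fun x => φ.1 x.1 j.2, by
        obtain ⟨p, hp, hx⟩ := φ.2.2.2 j.1.1 j.1.2 j.2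
        exact ⟨⟨p, (MvPolynomial.mem_restrictTotalDegree _ _ _).2 hp⟩,
          funext fun x => (hx x.1 x.2).symm⟩⟩
      map_add' := fun f g => rfl
      map_smul' := fun c f => rfl }
  refine FiniteDimensional.of_injective r ?_
  intro f g hfg
  apply Subtype.ext
  funext x i
  obtain ⟨K, hK, z, hz⟩ := M.covers x
  have h := congrFun (congrArg Subtype.val (congrFun hfg (⟨K, hK⟩, i))) ⟨x + lattice z, hz⟩
  have h' : f.1 (x + lattice z) i = g.1 (x + lattice z) i := h
  rwa [f.2.2.1 z x, g.2.2.1 z x] at h'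

theorem Uh_eq_zero {M : PeriodicMesh} {k : ℕ} {P : Pt → Fin 3 → ℝ} (hP : P ∈ Uh M k)
    (h : ∫ x in unitCell, ∑ i, P x i * P x i = 0) : P = 0 := by
  have hc : Continuous fun x => ∑ i, P x i * P x i := by
    have := hP.1
    fun_prop
  have h0 : ∀ x, 0 ≤ ∑ i, P x i * P x i :=
    fun x => Finset.sum_nonneg fun i _ => mul_self_nonneg _
  have hae := (setIntegral_eq_zero_iff_of_nonneg_ae (Filter.Eventually.of_forall h0)
    (hc.continuousOn.integrableOn_compact isCompact_Icc)).1 h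
  have hint : (interior unitCell) = Set.pi univ fun _ => Ioo (0 : ℝ) 1 := by
    rw [unitCell, ← Set.pi_univ_Icc, interior_pi_set Set.finite_univ]
    simp
  have hopen : ∀ x ∈ interior unitCell, (∑ i, P x i * P x i) = 0 := by
    have hae' : (fun x => ∑ i, P x i * P x i) =ᵐ[volume.restrict (interior unitCell)] 0 :=
      ae_mono (Measure.restrict_mono interior_subset le_rfl) hae
    exact fun x hx => Measure.eqOn_open_of_ae_eq hae' isOpen_interior
      hc.continuousOn continuousOn_const hx
  have hcell : ∀ x ∈ unitCell, (∑ i, P x i * P x i) = 0 := by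
    have hcl : closure (interior unitCell) = unitCell := by
      rw [hint, closure_pi_set]
      simp only [closure_Ioo (zero_ne_one' ℝ)]
      exact Set.pi_univ_Icc _ _
    intro x hx
    rw [← hcl] at hx
    exact closure_minimal (t := {y | (∑ i, P y i * P y i) = 0}) hopen
      (isClosed_eq hc continuous_const) hx
  funext x i
  have hx : x + lattice (fun j => -⌊x j⌋) ∈ unitCell := by
    constructor
    · intro j
      have := Int.floor_le (x j)
      simpa [lattice] using this
    · intro j
      have := (Int.fract_lt_one (x j)).le
      simp only [Int.fract] at this
      simpa [lattice, sub_eq_add_neg] using this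
  have h1 := hcell _ hx
  rw [hP.2.1] at h1
  exact mul_self_eq_zero.1
    ((Finset.sum_eq_zero_iff_of_nonneg fun i _ => mul_self_nonneg _).1 h1 i (Finset.mem_univ i))

theorem Uh_integrableOn {M : PeriodicMesh} {k : ℕ} {φ v : Pt → Fin 3 → ℝ} (hφ : φ ∈ Uh M k)
    (hv : ∀ i, IntegrableOn (fun x => v x i) unitCell) :
    IntegrableOn (fun x => ∑ i, v x i * φ x i) unitCell := by
  refine integrable_finsetSum _ fun i _ => ?_
  have := hφ.1
  exact IntegrableOn.mul_continuousOn (hv i) (by fun_prop) isCompact_Icc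

theorem exists_isL2Proj (M : PeriodicMesh) (k : ℕ) {v : Pt → Fin 3 → ℝ}
    (hv : ∀ i, IntegrableOn (fun x => v x i) unitCell) : ∃ P, IsL2Proj M k v P := by
  have hU : ∀ P ∈ Uh M k, ∀ i, IntegrableOn (fun x => P x i) unitCell := fun P hP i => by
    have := hP.1
    exact ContinuousOn.integrableOn_compact isCompact_Icc (by fun_prop)
  let I : ∀ w : Pt → Fin 3 → ℝ, (∀ i, IntegrableOn (fun x => w x i) unitCell) →
      Module.Dual ℝ (Uh M k) := fun w hw =>
    { toFun := fun φ => ∫ x in unitCell, ∑ i, w x i * φ.1 x i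
      map_add' := fun f g => by
        rw [← integral_add (Uh_integrableOn f.2 hw) (Uh_integrableOn g.2 hw)]
        simp [mul_add, Finset.sum_add_distrib]
      map_smul' := fun c f => by
        rw [RingHom.id_apply, smul_eq_mul, ← integral_const_mul]
        simp [Finset.mul_sum, mul_left_comm] }
  let B : Uh M k →ₗ[ℝ] Module.Dual ℝ (Uh M k) :=
    { toFun := fun P => I P.1 (hU P.1 P.2)
      map_add' := fun f g => by
        ext φ
        change (∫ x in unitCell, ∑ i, (f.1 x i + g.1 x i) * φ.1 x i) =
          (∫ x in unitCell, ∑ i, f.1 x i * φ.1 x i) + ∫ x in unitCell, ∑ i, g.1 x i * φ.1 x i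
        rw [← integral_add (Uh_integrableOn φ.2 (hU _ f.2)) (Uh_integrableOn φ.2 (hU _ g.2))]
        simp [add_mul, Finset.sum_add_distrib]
      map_smul' := fun c f => by
        ext φ
        change (∫ x in unitCell, ∑ i, (c * f.1 x i) * φ.1 x i) =
          c * ∫ x in unitCell, ∑ i, f.1 x i * φ.1 x i
        rw [← integral_const_mul]
        simp [Finset.mul_sum, mul_assoc] }
  have hB : Function.Injective B := by
    rw [← LinearMap.ker_eq_bot, LinearMap.ker_eq_bot']
    intro P hP
    exact Subtype.ext (Uh_eq_zero P.2 (DFunLike.congr_fun hP P))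
  obtain ⟨P, hP⟩ := (LinearMap.injective_iff_surjective_of_finrank_eq_finrank
    (Subspace.dual_finrank_eq).symm).1 hB (I v hv)
  refine ⟨P.1, P.2, fun φ hφ => ?_⟩
  have h : (∫ x in unitCell, ∑ i, P.1 x i * φ x i) = ∫ x in unitCell, ∑ i, v x i * φ x i :=
    DFunLike.congr_fun hP ⟨φ, hφ⟩
  simp only [sub_mul, Finset.sum_sub_distrib]
  rw [integral_sub (Uh_integrableOn hφ hv) (Uh_integrableOn hφ (hU _ P.2)), h, sub_self]

open Classical in
/-- The `L²(𝕋³)`-orthogonal projection `ℙ^U v` of `v` onto `U_h` (its continuous representative);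
it exists by `exists_isL2Proj`. -/
def projU (M : PeriodicMesh) (k : ℕ) (v : Pt → Fin 3 → ℝ) : Pt → Fin 3 → ℝ :=
  if h : ∃ P, IsL2Proj M k v P then h.choose else 0

theorem isL2Proj_projU (M : PeriodicMesh) (k : ℕ) {v : Pt → Fin 3 → ℝ}
    (hv : ∀ i, IntegrableOn (fun x => v x i) unitCell) : IsL2Proj M k v (projU M k v) := by
  have h := exists_isL2Proj M k hv
  rw [projU, dif_pos h]
  exact h.choose_spec

/-! ## The fully discrete scheme and its interpolants -/

/-- `(v^n, ξ^n)`, `n ≥ 0`, are iterates of the fully discrete scheme with time step `τ`: they lie in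
`U_h × H_h` and solve, for `n ≥ 1`,
`∫ (v^n - v^{n-1})_i/τ φ_i = - ∫ G_{,A}(ξ^n) Φ^A_{,iα}(F^{n-1}) ∂_α φ_i` for all `φ ∈ U_h`,
`∫ (ξ^n - ξ^{n-1})_A/τ ψ_A = ∫ Φ^A_{,iα}(F^{n-1}) ∂_α v^n_i ψ_A` for all `ψ ∈ H_h`.
(Elements of `U_h` are classically differentiable in the interior of each element.) -/
structure IsDiscreteSolution (G : Xi → ℝ) (M : PeriodicMesh) (k : ℕ) (τ : ℝ)
    (V : ℕ → Pt → Fin 3 → ℝ) (X : ℕ → Pt → Xi) : Prop where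
  mem_U : ∀ n, V n ∈ Uh M k
  mem_H : ∀ n, X n ∈ Hh M k
  momentum : ∀ n : ℕ, ∀ φ ∈ Uh M k,
    ∫ x in unitCell, ∑ i, (V (n + 1) x i - V n x i) / τ * φ x i =
      -∫ x in unitCell, ∑ i, ∑ α, ∑ A,
        dG G A (X (n + 1) x) * dPhi A i α (Fpart (X n x)) * pd α (fun y => φ y i) x
  kinematic : ∀ n : ℕ, ∀ ψ ∈ Hh M k,
    ∫ x in unitCell, ∑ A, (X (n + 1) x A - X n x A) / τ * ψ x A =
      ∫ x in unitCell, ∑ A, (∑ i, ∑ α,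
        dPhi A i α (Fpart (X n x)) * pd α (fun y => V (n + 1) y i) x) * ψ x A

/-- For `t ≥ 0`, the number `m = n - 1` with `t ∈ [(n-1)τ, nτ)`. -/
def stepIdx (τ t : ℝ) : ℕ := ⌊t / τ⌋₊

/-- Piecewise linear interpolant: `f^{n-1} + (t - τ(n-1))/τ (f^n - f^{n-1})` on `[(n-1)τ, nτ)`. -/
def hatInterp {β : Type*} (τ : ℝ) (f : ℕ → Pt → β → ℝ) (t : ℝ) (x : Pt) (b : β) : ℝ :=
  f (stepIdx τ t) x b +
    (t - τ * stepIdx τ t) / τ * (f (stepIdx τ t + 1) x b - f (stepIdx τ t) x b)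

/-- Piecewise constant interpolant: `f^n` on `[(n-1)τ, nτ)`. -/
def barInterp {β : Type*} (τ : ℝ) (f : ℕ → Pt → β) (t : ℝ) : Pt → β := f (stepIdx τ t + 1)

/-- Time-shifted piecewise constant interpolant: `f^{n-1}` on `[(n-1)τ, nτ)`. -/
def shiftInterp {β : Type*} (τ : ℝ) (f : ℕ → Pt → β) (t : ℝ) : Pt → β := f (stepIdx τ t)

/-- `δf = f^n - f^{n-1}` on `[(n-1)τ, nτ)`. -/
def increment {β : Type*} (τ : ℝ) (f : ℕ → Pt → β → ℝ) (t : ℝ) (x : Pt) : β → ℝ :=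
  f (stepIdx τ t + 1) x - f (stepIdx τ t) x

/-! ## Solutions of the extended elasticity system -/

/-- `(v, ξ)` is a (continuously differentiable) periodic solution on `𝕋³ × [0,T]` of
`∂_t v_i = ∂_α (G_{,A}(ξ) Φ^A_{,iα}(F))`, `∂_t ξ_A = ∂_α (Φ^A_{,iα}(F) v_i)`. -/
structure IsSmoothSolution (G : Xi → ℝ) (T : ℝ) (v : ℝ → Pt → Fin 3 → ℝ) (ξ : ℝ → Pt → Xi) :
    Prop where
  periodic_v : ∀ t ∈ Icc 0 T, IsPeriodic (v t)
  periodic_ξ : ∀ t ∈ Icc 0 T, IsPeriodic (ξ t)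
  smooth_v : ContDiffOn ℝ 1 (fun p : ℝ × Pt => v p.1 p.2) (Icc 0 T ×ˢ univ)
  smooth_ξ : ContDiffOn ℝ 1 (fun p : ℝ × Pt => ξ p.1 p.2) (Icc 0 T ×ˢ univ)
  momentum : ∀ t ∈ Ioo 0 T, ∀ (x : Pt) (i : Fin 3),
    deriv (fun s => v s x i) t =
      ∑ α, pd α (fun y => ∑ A, dG G A (ξ t y) * dPhi A i α (Fpart (ξ t y))) x
  kinematic : ∀ t ∈ Ioo 0 T, ∀ (x : Pt) (A : Idx),
    deriv (fun s => ξ s x A) t =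
      ∑ α, pd α (fun y => ∑ i, dPhi A i α (Fpart (ξ t y)) * v t y i) x

/-! ## The relative entropy and the terms of the identity -/

/-- The entropy `η(v, ξ) = |v|²/2 + G(ξ)`. -/
def entropy (G : Xi → ℝ) (Θ : (Fin 3 → ℝ) × Xi) : ℝ := (∑ i, Θ.1 i ^ 2) / 2 + G Θ.2

/-- The relative entropy `η(Θ̂) - η(Θ) - Dη(Θ)(Θ̂ - Θ)`. -/
def relEntropy (G : Xi → ℝ) (Θh Θ : (Fin 3 → ℝ) × Xi) : ℝ :=
  entropy G Θh - entropy G Θ - fderiv ℝ (entropy G) Θ (Θh - Θ)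

/-- `D = (∇η(Θ̄) - ∇η(Θ̂)) · δΘ`. -/
def termD (G : Xi → ℝ) (Θb Θh δΘ : (Fin 3 → ℝ) × Xi) : ℝ :=
  (fderiv ℝ (entropy G) Θb - fderiv ℝ (entropy G) Θh) δΘ

/-- `Q` at the point `x`; `vh`, `ξh` are the values at `x` of the piecewise linear interpolants, and
`v`, `ξ` are the exact solution at a fixed time. -/
def termQ (G : Xi → ℝ) (vh : Fin 3 → ℝ) (ξh : Xi) (v : Pt → Fin 3 → ℝ) (ξ : Pt → Xi)
    (x : Pt) : ℝ :=
  ∑ A, ∑ i, ∑ α,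
    (pd α (fun y => dG G A (ξ y)) x
        * (dPhi A i α (Fpart ξh) - dPhi A i α (Fpart (ξ x))) * (vh i - v x i)
      + pd α (fun y => v y i) x
        * (dG G A ξh - dG G A (ξ x)) * (dPhi A i α (Fpart ξh) - dPhi A i α (Fpart (ξ x)))
      + pd α (fun y => v y i) x
        * (dG G A ξh - dG G A (ξ x) - ∑ B, ddG G A B (ξ x) * (ξh B - ξ x B))
        * dPhi A i α (Fpart (ξ x)))

/-- `E` at the point `x`; `vb`, `ξb`, `Fs` are the values at `x` of the piecewise constant
interpolants `v̄`, `ξ̄`, `F̄_*`. -/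
def termE (G : Xi → ℝ) (vb : Fin 3 → ℝ) (ξb : Xi) (Fs : Mat3) (vh : Fin 3 → ℝ) (ξh : Xi)
    (v : Pt → Fin 3 → ℝ) (ξ : Pt → Xi) (x : Pt) : ℝ :=
  ∑ A, ∑ i, ∑ α,
    (pd α (fun y => dG G A (ξ y)) x *
        (dPhi A i α (Fpart (ξ x)) * (vb i - vh i)
          + (dPhi A i α (Fpart ξh) - dPhi A i α (Fpart (ξ x))) * (vb i - vh i)
          + (dPhi A i α Fs - dPhi A i α (Fpart ξh)) * (vb i - vh i)
          + (dPhi A i α Fs - dPhi A i α (Fpart ξh)) * (vh i - v x i))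
      + pd α (fun y => v y i) x *
        ((dG G A ξb - dG G A ξh) * dPhi A i α (Fpart (ξ x))
          + (dG G A ξb - dG G A ξh) * (dPhi A i α Fs - dPhi A i α (Fpart ξh))
          + (dG G A ξb - dG G A ξh) * (dPhi A i α (Fpart ξh) - dPhi A i α (Fpart (ξ x)))
          + (dG G A ξh - dG G A (ξ x)) * (dPhi A i α Fs - dPhi A i α (Fpart ξh))))

/-- `Ē = G_{,A}(ξ̄) Φ^A_{,iα}(F̄_*) ∂_α (ℙ^U v - v)_i` at the point `x`. -/
def termEbar (G : Xi → ℝ) (M : PeriodicMesh) (k : ℕ) (ξb : Xi) (Fs : Mat3) (v : Pt → Fin 3 → ℝ)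
    (x : Pt) : ℝ :=
  ∑ A, ∑ i, ∑ α, dG G A ξb * dPhi A i α Fs * pd α (fun y => projU M k v y i - v y i) x

end

end Elasto

open Elasto

open Filter Topology
open scoped NNReal ENNReal

namespace Elasto

/-! ### Periodic functions -/

/-! Off the time grid, differentiating `η^r` gives (`hasDerivAt_relEntropy`) `(v̂-v)·δv/τ - ∂_t
v·(v̂-v) + (G_{,A}(ξ̂)-G_{,A}(ξ)) δξ_A/τ - G_{,AB}(ξ) ∂_tξ_B (ξ̂-ξ)_A`. Here `δξ/τ` may be replaced
a.e. by `Φ^A_{,iα}(F^{n-1}) ∂_α v^n_i`, because the degrees in `H_h` are exactly those of this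
product (`kinematic_ae`), and `∂_t v`, `∂_t ξ` by the nonconservative form of the exact system
(`momentum_eq`, `kinematic_eq`). Finite-sum algebra (`relEntropy_algebra`) then shows that, for a.e.
`x`, the result is the claimed integrand plus four terms of integral zero: the discrete momentum
balance tested with `v^n`, the same tested with `ℙ^U v`, the pairing of `v - ℙ^U v` with `δv ∈ U_h`,
and `Φ^A_{,iα}(F^{n-1}) ∂_α(G_{,A}(ξ)(v^n-v)_i)`.

The last term, like the nonconservative form, rests on the null Lagrangian identity
`∂_α(Φ^A_{,iα}(F)) = 0` for curl-free `F`. It is checked by hand for `C¹` fields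
(`sum_pd_dPhi_eq_zero`). The discrete `F^{n-1}` is only bounded, so there the identity is used
weakly: mollification preserves curl-freeness and bounds, and dominated convergence passes to the
limit (`WeakCurlFree.setIntegral_dPhi_mul_pd`). Curl-freeness propagates from the initial data
because the `F`-components of both systems say that `F` changes by gradients of the velocity.

Integration by parts needs no jump terms: continuous cellwise polynomials are globally Lipschitz
(`Uh_torusLip`), so by Rademacher their classical derivatives exist a.e. and are the weak ones. -/

theorem exists_add_lattice_mem_unitCell (x : Pt) : ∃ z, x + lattice z ∈ unitCell := by
  refine ⟨fun j => -⌊x j⌋, fun j => ?_, fun j => ?_⟩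
  · have := Int.floor_le (x j)
    simpa [lattice] using this
  · have := (Int.fract_lt_one (x j)).le
    simp only [Int.fract] at this
    simpa [lattice, sub_eq_add_neg] using this

theorem measurableSet_unitCell : MeasurableSet unitCell := measurableSet_Icc

theorem isCompact_unitCell : IsCompact unitCell := isCompact_Icc

theorem IsPeriodic.comp {β γ : Type*} {f : Pt → β} (hf : IsPeriodic f) (g : β → γ) :
    IsPeriodic (fun x => g (f x)) := fun z x => congrArg g (hf z x)

theorem IsPeriodic.comp₂ {β γ δ : Type*} {f : Pt → β} {f' : Pt → γ} (hf : IsPeriodic f)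
    (hf' : IsPeriodic f') (g : β → γ → δ) : IsPeriodic (fun x => g (f x) (f' x)) :=
  fun z x => congrArg₂ g (hf z x) (hf' z x)

theorem IsPeriodic.fderiv {f : Pt → ℝ} (hf : IsPeriodic f) : IsPeriodic (fderiv ℝ f) := by
  intro z x
  have h : (fun y => f (y + lattice z)) = f := funext (hf z)
  have := fderiv_comp_add_right (𝕜 := ℝ) (f := f) (x := x) (lattice z)
  rw [h] at this
  exact this.symm

theorem IsPeriodic.pd {f : Pt → ℝ} (hf : IsPeriodic f) (α : Fin 3) : IsPeriodic (pd α f) :=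
  hf.fderiv.comp (fun L => L (Pi.single α 1))

theorem IsPeriodic.forall_of_unitCell {p : Pt → Prop} (hp : IsPeriodic p)
    (h : ∀ x ∈ unitCell, p x) (x : Pt) : p x := by
  obtain ⟨z, hz⟩ := exists_add_lattice_mem_unitCell x
  have := h _ hz
  rwa [hp z x] at this

/-- Countably many lattice translates of the cell cover space, and translations preserve null sets.
-/
theorem IsPeriodic.ae_of_unitCell {p : Pt → Prop} (hp : IsPeriodic p)
    (h : ∀ᵐ x ∂(volume.restrict unitCell), p x) : ∀ᵐ x, p x := by
  have h1 : ∀ᵐ x, x ∈ unitCell → p x := (ae_restrict_iff' measurableSet_Icc).1 h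
  have h2 : ∀ z : Fin 3 → ℤ, ∀ᵐ x : Pt, x + lattice z ∈ unitCell → p (x + lattice z) := fun z =>
    (measurePreserving_add_right volume (lattice z)).quasiMeasurePreserving.ae h1
  filter_upwards [ae_all_iff.2 h2] with x hx
  obtain ⟨z, hz⟩ := exists_add_lattice_mem_unitCell x
  have := hx z hz
  rwa [hp z x] at this

theorem IsPeriodic.exists_bound {E : Type*} [SeminormedAddCommGroup E] {f : Pt → E}
    (hf : IsPeriodic f) (hc : Continuous f) : ∃ C : ℝ≥0, ∀ x, ‖f x‖ ≤ C := by
  obtain ⟨C, hC⟩ := isCompact_unitCell.exists_bound_of_continuousOn hc.continuousOn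
  refine ⟨⟨max C 0, le_max_right _ _⟩, ?_⟩
  exact (hf.comp (fun y => ‖y‖ ≤ max C 0)).forall_of_unitCell
    fun x hx => (hC x hx).trans (le_max_left _ _)

theorem unitCell_ae_eq :
    unitCell =ᵐ[volume] ZSpan.fundamentalDomain (Pi.basisFun ℝ (Fin 3)) := by
  have : ZSpan.fundamentalDomain (Pi.basisFun ℝ (Fin 3)) = Set.pi univ fun _ => Ico (0:ℝ) 1 := by
    ext x; simp [ZSpan.mem_fundamentalDomain]
  rw [this]
  exact (Measure.univ_pi_Ico_ae_eq_Icc (f := (0 : Pt)) (g := (1 : Pt))).symm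

/-- A translate of a fundamental domain of `ℤ³` is again one, and a periodic function has the same
integral over all of them. -/
theorem IsPeriodic.setIntegral_add {f : Pt → ℝ} (hf : IsPeriodic f) (c : Pt) :
    ∫ x in unitCell, f (x + c) = ∫ x in unitCell, f x := by
  have hD := ZSpan.isAddFundamentalDomain' (Pi.basisFun ℝ (Fin 3)) (volume : Measure Pt)
  have hper : ∀ (g : (Submodule.span ℤ (range (Pi.basisFun ℝ (Fin 3)))).toAddSubgroup) (x : Pt),
      f (g +ᵥ x) = f x := by
    intro g x
    have hg : (g : Pt) ∈ Submodule.span ℤ (range (Pi.basisFun ℝ (Fin 3))) := g.2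
    rw [(Pi.basisFun ℝ (Fin 3)).mem_span_iff_repr_mem ℤ] at hg
    choose z hz using hg
    have : (g : Pt) = lattice z := by
      ext i
      have := hz i
      simp at this
      simp [lattice, this]
    rw [AddSubgroup.vadd_def, vadd_eq_add, add_comm, this, hf]
  have : Countable (Submodule.span ℤ (range (Pi.basisFun ℝ (Fin 3)))).toAddSubgroup :=
    inferInstanceAs (Countable (Submodule.span ℤ (range (Pi.basisFun ℝ (Fin 3)))))
  have hD' := hD.vadd_of_comm c
  rw [setIntegral_congr_set unitCell_ae_eq, setIntegral_congr_set unitCell_ae_eq,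
    hD.setIntegral_eq hD' hper]
  have := (measurePreserving_add_right (volume : Measure Pt) c).setIntegral_image_emb
    (measurableEmbedding_addRight c) f (ZSpan.fundamentalDomain (Pi.basisFun ℝ (Fin 3)))
  rw [← this]
  simp only [add_comm _ c]
  rfl

/-! ### Lipschitz functions on the torus -/

/-- Lipschitz functions on the torus. -/
def TorusLip (f : Pt → ℝ) : Prop := IsPeriodic f ∧ ∃ C, LipschitzWith C f

namespace TorusLip

variable {f g : Pt → ℝ}

theorem continuous (hf : TorusLip f) : Continuous f := hf.2.choose_spec.continuous

theorem ae_differentiableAt (hf : TorusLip f) : ∀ᵐ x, DifferentiableAt ℝ f x :=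
  hf.2.choose_spec.ae_differentiableAt

/-- Periodicity is essential: it makes both factors bounded, without which a product of Lipschitz
functions need not be Lipschitz. -/
theorem mul (hf : TorusLip f) (hg : TorusLip g) : TorusLip (fun x => f x * g x) := by
  obtain ⟨C, hC⟩ := hf.1.exists_bound hf.continuous
  obtain ⟨D, hD⟩ := hg.1.exists_bound hg.continuous
  obtain ⟨K, hK⟩ := hf.2
  obtain ⟨L, hL⟩ := hg.2
  refine ⟨hf.1.comp₂ hg.1 _, C * L + K * D, LipschitzWith.of_dist_le_mul fun x y => ?_⟩
  have h1 := hK.dist_le_mul x y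
  have h2 := hL.dist_le_mul x y
  rw [Real.dist_eq] at *
  have : f x * g x - f y * g y = f x * (g x - g y) + (f x - f y) * g y := by ring
  rw [this]
  refine (abs_add_le _ _).trans ?_
  rw [abs_mul, abs_mul]
  have h3 := hC x
  have h4 := hD y
  rw [Real.norm_eq_abs] at h3 h4
  push_cast
  calc _ ≤ C * (L * dist x y) + (K * dist x y) * D := by gcongr
    _ = _ := by ring

theorem sub (hf : TorusLip f) (hg : TorusLip g) : TorusLip (fun x => f x - g x) := by
  obtain ⟨K, hK⟩ := hf.2
  obtain ⟨L, hL⟩ := hg.2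
  exact ⟨hf.1.comp₂ hg.1 _, K + L, hK.sub hL⟩

theorem of_contDiff (hf : IsPeriodic f) (h : ContDiff ℝ 1 f) : TorusLip f := by
  obtain ⟨C, hC⟩ := hf.fderiv.exists_bound (h.continuous_fderiv one_ne_zero)
  exact ⟨hf, C, lipschitzWith_of_nnnorm_fderiv_le (h.differentiable one_ne_zero) hC⟩

theorem ae_pd_eq_lineDeriv (hf : TorusLip f) (α : Fin 3) :
    ∀ᵐ x, pd α f x = lineDeriv ℝ f x (Pi.single α 1) := by
  filter_upwards [hf.ae_differentiableAt] with x hx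
  exact hx.lineDeriv_eq_fderiv.symm

theorem memLp_pd (hf : TorusLip f) (α : Fin 3) : MemLp (pd α f) ⊤ volume := by
  obtain ⟨C, hC⟩ := hf.2
  exact (hC.memLp_lineDeriv (Pi.single α 1)).ae_eq
    ((hf.ae_pd_eq_lineDeriv α).mono fun x hx => hx.symm)

/-- Each difference quotient has integral zero over the cell by translation invariance. For
Lipschitz `f` these integrals, weighted by the indicator of the cell, converge to the integral of
the directional derivative. -/
theorem setIntegral_pd (hf : TorusLip f) (α : Fin 3) : ∫ x in unitCell, pd α f x = 0 := by
  obtain ⟨C, hC⟩ := hf.2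
  set e : Pt := Pi.single α 1
  have h1 : ∫ x in unitCell, pd α f x = ∫ x, lineDeriv ℝ f x e *
      unitCell.indicator (fun _ => (1 : ℝ)) x := by
    rw [setIntegral_congr_ae (g := fun x => lineDeriv ℝ f x e) measurableSet_unitCell
      ((hf.ae_pd_eq_lineDeriv α).mono fun x hx _ => hx), ← integral_indicator measurableSet_unitCell]
    congr 1; ext x
    by_cases hx : x ∈ unitCell <;> simp [hx]
  have hint : Integrable (unitCell.indicator (fun _ : Pt => (1 : ℝ))) :=
    (integrableOn_const (by exact isCompact_unitCell.measure_lt_top.ne)).integrable_indicator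
      measurableSet_unitCell
  have h2 := hC.integral_inv_smul_sub_mul_tendsto_integral_lineDeriv_mul hint e
  rw [← h1] at h2
  refine tendsto_nhds_unique h2 (tendsto_const_nhds.congr fun s => ?_)
  have : ∀ x, (s⁻¹ • (f (x + s • e) - f x)) * unitCell.indicator (fun _ => (1 : ℝ)) x =
      unitCell.indicator (fun x => s⁻¹ * (f (x + s • e) - f x)) x := by
    intro x
    by_cases hx : x ∈ unitCell <;> simp [hx]
  have hI : ∀ c, IntegrableOn (fun x => f (x + c)) unitCell := fun c =>
    ContinuousOn.integrableOn_compact isCompact_unitCell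
      (hf.continuous.comp (continuous_id.add continuous_const)).continuousOn
  have hI0 : IntegrableOn f unitCell := by simpa using hI 0
  simp_rw [this]
  rw [integral_indicator measurableSet_unitCell]
  change 0 = ∫ x in unitCell, _
  rw [integral_const_mul, integral_sub (hI _) hI0, hf.1.setIntegral_add, sub_self, mul_zero]

end TorusLip

/-! ### Explicit formulas for the derivatives of the null Lagrangians -/

/-- Indices are cyclic modulo 3; this ordering of the minor absorbs the sign `(-1)^(j+β)` of the
cofactor. -/
theorem Phi_Z (F : Mat3) (j β : Fin 3) : Phi F (Sum.inr (Sum.inl (j, β))) =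
    F (j + 1) (β + 1) * F (j + 2) (β + 2) - F (j + 1) (β + 2) * F (j + 2) (β + 1) := by
  simp only [Phi, Matrix.transpose_apply, Matrix.adjugate_fin_three]
  fin_cases j <;> fin_cases β <;> simp <;> ring

theorem Phi_w (F : Mat3) (u : Unit) : Phi F (Sum.inr (Sum.inr u)) =
    F 0 0 * (F 1 1 * F 2 2 - F 1 2 * F 2 1) + F 0 1 * (F 1 2 * F 2 0 - F 1 0 * F 2 2)
      + F 0 2 * (F 1 0 * F 2 1 - F 1 1 * F 2 0) := by
  simp only [Phi, Matrix.det_fin_three, Matrix.of_apply]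
  ring

theorem contDiff_Phi (A : Idx) : ContDiff ℝ ⊤ (fun F : Mat3 => Phi F A) := by
  rcases A with ⟨j, β⟩ | ⟨j, β⟩ | u
  · change ContDiff ℝ ⊤ (fun F : Mat3 => F j β)
    fun_prop
  · simp only [Phi_Z]
    fun_prop
  · simp only [Phi_w]
    fun_prop

theorem contDiff_dPhi (A : Idx) (i α : Fin 3) : ContDiff ℝ 2 (dPhi A i α) := by
  have := (contDiff_Phi A).fderiv_right (m := 2) (by simp)
  exact this.clm_apply contDiff_const

/-- The coordinate `F ↦ F i α` as a continuous linear map. -/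
noncomputable def entry (i α : Fin 3) : Mat3 →L[ℝ] ℝ :=
  (ContinuousLinearMap.proj (R := ℝ) (φ := fun _ : Fin 3 => ℝ) α).comp
    (ContinuousLinearMap.proj (R := ℝ) (φ := fun _ : Fin 3 => Fin 3 → ℝ) i)

theorem hasFDerivAt_entry (i α : Fin 3) (F : Mat3) :
    HasFDerivAt (fun F : Mat3 => F i α) (entry i α) F := (entry i α).hasFDerivAt

theorem entry_single (i α j β : Fin 3) :
    entry j β (Pi.single i (Pi.single α 1)) = if i = j ∧ α = β then 1 else 0 := by
  simp only [entry, ContinuousLinearMap.comp_apply, ContinuousLinearMap.proj_apply]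
  by_cases h : i = j
  · subst h; simp [Pi.single_apply, eq_comm]
  · simp [h, eq_comm]

theorem dPhi_F (j β i α : Fin 3) (F : Mat3) :
    dPhi (Sum.inl (j, β)) i α F = if i = j ∧ α = β then 1 else 0 := by
  rw [dPhi, ← entry_single]
  exact congrArg (fun L : Mat3 →L[ℝ] ℝ => L (Pi.single i (Pi.single α 1)))
    (hasFDerivAt_entry j β F).fderiv

/-- Besides the divergence computation, this explicit form displays the degree in `F`: zero for the
`F`-block, one here, two for `det`. These degrees drive `cellPoly_dPhi_mul`. -/
theorem dPhi_Z (j β i α : Fin 3) (F : Mat3) :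
    dPhi (Sum.inr (Sum.inl (j, β))) i α F =
      (if i = j + 1 ∧ α = β + 1 then 1 else 0) * F (j + 2) (β + 2)
      + (if i = j + 2 ∧ α = β + 2 then 1 else 0) * F (j + 1) (β + 1)
      - (if i = j + 1 ∧ α = β + 2 then 1 else 0) * F (j + 2) (β + 1)
      - (if i = j + 2 ∧ α = β + 1 then 1 else 0) * F (j + 1) (β + 2) := by
  have h := (((hasFDerivAt_entry (j + 1) (β + 1) F).mul (hasFDerivAt_entry (j + 2) (β + 2) F)).sub
    ((hasFDerivAt_entry (j + 1) (β + 2) F).mul (hasFDerivAt_entry (j + 2) (β + 1) F)))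
  have h' : HasFDerivAt (fun F => Phi F (Sum.inr (Sum.inl (j, β)))) _ F :=
    h.congr_of_eventuallyEq (Eventually.of_forall fun F => Phi_Z F j β)
  rw [dPhi, h'.fderiv]
  simp only [sub_apply, add_apply,
    smul_apply, entry_single, smul_eq_mul]
  ring

theorem dPhi_w (u : Unit) (i α : Fin 3) (F : Mat3) :
    dPhi (Sum.inr (Sum.inr u)) i α F =
      F (i + 1) (α + 1) * F (i + 2) (α + 2) - F (i + 1) (α + 2) * F (i + 2) (α + 1) := by
  have e := fun i α => hasFDerivAt_entry i α F
  have h := (((e 0 0).mul (((e 1 1).mul (e 2 2)).sub ((e 1 2).mul (e 2 1)))).add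
    ((e 0 1).mul (((e 1 2).mul (e 2 0)).sub ((e 1 0).mul (e 2 2))))).add
    ((e 0 2).mul (((e 1 0).mul (e 2 1)).sub ((e 1 1).mul (e 2 0))))
  have h' : HasFDerivAt (fun F => Phi F (Sum.inr (Sum.inr u))) _ F :=
    h.congr_of_eventuallyEq (Eventually.of_forall fun F => Phi_w F u)
  rw [dPhi, h'.fderiv]
  simp only [sub_apply, add_apply,
    smul_apply, entry_single, smul_eq_mul]
  fin_cases i <;> fin_cases α <;> simp <;> ring

/-- The null Lagrangian identity `∂_α (Φ^A_{,iα}(F)) = 0` at a point where `F` is curl free. -/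
theorem sum_pd_dPhi_eq_zero {F : Pt → Mat3} {x : Pt} (hF : DifferentiableAt ℝ F x)
    (hcurl : ∀ i β γ, pd γ (fun y => F y i β) x = pd β (fun y => F y i γ) x)
    (A : Idx) (i : Fin 3) : ∑ α, pd α (fun y => dPhi A i α (F y)) x = 0 := by
  have hd : ∀ i α, DifferentiableAt ℝ (fun y => F y i α) x := fun i α =>
    (entry i α).differentiableAt.comp x hF
  rcases A with ⟨j, β⟩ | ⟨j, β⟩ | u
  · simp [dPhi_F, pd]
  · have key : ∀ α, pd α (fun y => dPhi (Sum.inr (Sum.inl (j, β))) i α (F y)) x =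
      (if i = j + 1 ∧ α = β + 1 then 1 else 0) * pd α (fun y => F y (j + 2) (β + 2)) x
      + (if i = j + 2 ∧ α = β + 2 then 1 else 0) * pd α (fun y => F y (j + 1) (β + 1)) x
      - (if i = j + 1 ∧ α = β + 2 then 1 else 0) * pd α (fun y => F y (j + 2) (β + 1)) x
      - (if i = j + 2 ∧ α = β + 1 then 1 else 0) * pd α (fun y => F y (j + 1) (β + 2)) x := by
      intro α
      have d := fun i α => (hd i α).hasFDerivAt
      have h := ((((d (j + 2) (β + 2)).const_mul (if i = j + 1 ∧ α = β + 1 then 1 else 0)).add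
        ((d (j + 1) (β + 1)).const_mul (if i = j + 2 ∧ α = β + 2 then 1 else 0))).sub
        ((d (j + 2) (β + 1)).const_mul (if i = j + 1 ∧ α = β + 2 then 1 else 0))).sub
        ((d (j + 1) (β + 2)).const_mul (if i = j + 2 ∧ α = β + 1 then 1 else 0))
      have h' : HasFDerivAt (fun y => dPhi (Sum.inr (Sum.inl (j, β))) i α (F y)) _ x :=
        h.congr_of_eventuallyEq (Eventually.of_forall fun y => dPhi_Z j β i α (F y))
      rw [pd, h'.fderiv]
      simp only [sub_apply, add_apply, smul_apply, smul_eq_mul, pd]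
    simp only [key, Finset.sum_add_distrib, Finset.sum_sub_distrib, ite_and, ite_mul, one_mul,
      zero_mul]
    -- For `i = j + 1` the two surviving terms are the mixed derivatives of row `j + 2`, and for `i
    -- = j + 2` those of row `j + 1`; every other row gives zero.
    have h1 := hcurl (j + 1) (β + 1) (β + 2)
    have h2 := hcurl (j + 2) (β + 1) (β + 2)
    by_cases hi : i = j + 1 <;> by_cases hi' : i = j + 2 <;> simp [hi, hi', h1, h2]
  · have key : ∀ α, pd α (fun y => dPhi (Sum.inr (Sum.inr u)) i α (F y)) x =
      F x (i + 1) (α + 1) * pd α (fun y => F y (i + 2) (α + 2)) x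
      + F x (i + 2) (α + 2) * pd α (fun y => F y (i + 1) (α + 1)) x
      - (F x (i + 1) (α + 2) * pd α (fun y => F y (i + 2) (α + 1)) x
      + F x (i + 2) (α + 1) * pd α (fun y => F y (i + 1) (α + 2)) x) := by
      intro α
      have d := fun i α => (hd i α).hasFDerivAt
      have h := ((d (i + 1) (α + 1)).mul (d (i + 2) (α + 2))).sub
        ((d (i + 1) (α + 2)).mul (d (i + 2) (α + 1)))
      have h' : HasFDerivAt (fun y => dPhi (Sum.inr (Sum.inr u)) i α (F y)) _ x :=
        h.congr_of_eventuallyEq (Eventually.of_forall fun y => dPhi_w u i α (F y))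
      rw [pd, h'.fderiv]
      simp [pd]
    simp only [key, Fin.sum_univ_three]
    have c := hcurl
    simp only [show (0 : Fin 3) + 1 = 1 from rfl, show (0 : Fin 3) + 2 = 2 from rfl,
      show (1 : Fin 3) + 1 = 2 from rfl, show (1 : Fin 3) + 2 = 0 from rfl,
      show (2 : Fin 3) + 1 = 0 from rfl, show (2 : Fin 3) + 2 = 1 from rfl]
    -- The twelve terms pair up into six curl components of rows `i + 1` and `i + 2`, each weighted
    -- by an entry of the other row.
    linear_combination F x (i + 1) 1 * c (i + 2) 2 0 + F x (i + 2) 2 * c (i + 1) 1 0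
      - F x (i + 1) 2 * c (i + 2) 1 0 - F x (i + 2) 1 * c (i + 1) 2 0
      - F x (i + 1) 0 * c (i + 2) 2 1 - F x (i + 2) 0 * c (i + 1) 1 2


/-! ### Polynomials in three variables -/

theorem contDiff_eval (p : MvPolynomial (Fin 3) ℝ) :
    ContDiff ℝ 1 (fun x : Pt => MvPolynomial.eval x p) := by
  induction p using MvPolynomial.induction_on with
  | C a => simpa using contDiff_const
  | add p q hp hq => simpa using hp.add hq
  | mul_X p i hp => simpa using hp.mul (contDiff_apply ℝ ℝ i)

theorem pd_eval (α : Fin 3) (p : MvPolynomial (Fin 3) ℝ) (x : Pt) :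
    pd α (fun x : Pt => MvPolynomial.eval x p) x =
      MvPolynomial.eval x (MvPolynomial.pderiv α p) := by
  have hd := fun p => ((contDiff_eval p).differentiable one_ne_zero x).hasFDerivAt
  induction p using MvPolynomial.induction_on with
  | C a => simp [pd]
  | add p q hp hq =>
    have h := ((hd p).add (hd q)).fderiv
    simp only [map_add, ← hp, ← hq]
    rw [pd]
    erw [h]
    rfl
  | mul_X p i hp =>
    have hX : HasFDerivAt (fun x : Pt => x i) (ContinuousLinearMap.proj i) x :=
      (ContinuousLinearMap.proj (R := ℝ) (φ := fun _ : Fin 3 => ℝ) i).hasFDerivAt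
    have h := ((hd p).mul hX).fderiv
    simp only [map_mul, MvPolynomial.eval_X, Derivation.leibniz, map_add, smul_eq_mul, ← hp]
    rw [pd]
    erw [h]
    simp only [add_apply, smul_apply, smul_eq_mul, pd, MvPolynomial.pderiv_X, Pi.single_apply,
      ContinuousLinearMap.proj_apply]
    congr 2
    split_ifs <;> simp_all

theorem totalDegree_pderiv_le (α : Fin 3) (p : MvPolynomial (Fin 3) ℝ) :
    (MvPolynomial.pderiv α p).totalDegree ≤ p.totalDegree - 1 := by
  refine Finset.sup_le fun m hm => ?_
  rw [MvPolynomial.mem_support_iff, MvPolynomial.coeff_pderiv] at hm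
  have h : m + Finsupp.single α 1 ∈ p.support :=
    MvPolynomial.mem_support_iff.2 (left_ne_zero_of_mul hm)
  have := MvPolynomial.le_totalDegree h
  rw [Finsupp.sum_add_index' (by simp) (by simp)] at this
  simp at this ⊢
  omega

/-! ### Cells of the mesh -/

namespace PeriodicMesh

variable {M : PeriodicMesh} {K : Set Pt}

theorem convex (hK : K ∈ M.cells) : Convex ℝ K := by
  obtain ⟨s, rfl⟩ := M.polytope K hK
  exact convex_convexHull ℝ _

theorem isCompact (hK : K ∈ M.cells) : IsCompact K := by
  obtain ⟨s, rfl⟩ := M.polytope K hK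
  exact s.finite_toSet.isCompact_convexHull ℝ

theorem measurableSet (hK : K ∈ M.cells) : MeasurableSet K := (isCompact hK).measurableSet

/-- The frontier of a convex set is Lebesgue null. -/
theorem ae_mem_interior (hK : K ∈ M.cells) : ∀ᵐ x ∂(volume.restrict K), x ∈ interior K := by
  rw [ae_restrict_iff' (measurableSet hK)]
  have h : ∀ᵐ x : Pt, x ∉ frontier K :=
    measure_eq_zero_iff_ae_notMem.1 ((convex hK).addHaar_frontier volume)
  filter_upwards [h] with x hx hxK
  by_contra hi
  exact hx ⟨subset_closure hxK, hi⟩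

theorem ae_of_cells {p : Pt → Prop} (hp : IsPeriodic p)
    (h : ∀ K ∈ M.cells, ∀ᵐ x ∂(volume.restrict K), p x) : ∀ᵐ x, p x := by
  have h1 : ∀ (z : Fin 3 → ℤ) (K : M.cells), ∀ᵐ x : Pt, x + lattice z ∈ K.1 → p (x + lattice z) :=
    fun z K => (measurePreserving_add_right volume (lattice z)).quasiMeasurePreserving.ae
      ((ae_restrict_iff' (measurableSet K.2)).1 (h K.1 K.2))
  have h2 : ∀ z : Fin 3 → ℤ, ∀ᵐ x : Pt, ∀ K : M.cells, x + lattice z ∈ K.1 → p (x + lattice z) :=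
    fun z => ae_all_iff.2 (h1 z)
  filter_upwards [ae_all_iff.2 h2] with x hx
  obtain ⟨K, hK, z, hz⟩ := M.covers x
  have := hx z ⟨K, hK⟩ hz
  rwa [hp z x] at this

theorem aestronglyMeasurable_of_cells {f : Pt → ℝ} (hf : IsPeriodic f)
    (h : ∀ K ∈ M.cells, AEStronglyMeasurable f (volume.restrict K)) :
    AEStronglyMeasurable f volume := by
  have hU : (⋃ j : (Fin 3 → ℤ) × M.cells, (fun x => x + lattice j.1) ⁻¹' j.2.1) = univ := by
    refine eq_univ_of_forall fun x => ?_
    obtain ⟨K, hK, z, hz⟩ := M.covers x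
    exact mem_iUnion.2 ⟨(z, ⟨K, hK⟩), hz⟩
  rw [← Measure.restrict_univ (μ := (volume : Measure Pt)), ← hU, aestronglyMeasurable_iUnion_iff]
  rintro ⟨z, K, hK⟩
  have hm := (measurePreserving_add_right (volume : Measure Pt) (lattice z)).restrict_preimage
    (measurableSet hK)
  have := (h K hK).comp_measurePreserving hm
  exact this.congr (Eventually.of_forall fun x => hf z x)

/-- A continuous periodic function which is Lipschitz on every cell is Lipschitz. -/
theorem lipschitzWith_of_cells {f : Pt → ℝ} (hf : IsPeriodic f) (hc : Continuous f) {L : ℝ≥0}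
    (h : ∀ K ∈ M.cells, LipschitzOnWith L f K) : LipschitzWith L f := by
  suffices H : ∀ x y, f y - f x ≤ L * dist x y by
    refine LipschitzWith.of_dist_le_mul fun x y => ?_
    rw [Real.dist_eq, abs_le]
    have h1 := H x y
    have h2 := H y x
    rw [dist_comm] at h2
    constructor <;> linarith
  intro x y
  set γ : ℝ → Pt := fun s => x + s • (y - x)
  have hγ : Continuous γ := by fun_prop
  have hγd : ∀ s t, dist (γ s) (γ t) = |s - t| * dist x y := by
    intro s t
    rw [dist_eq_norm, dist_comm x y, dist_eq_norm]
    simp only [γ, add_sub_add_left_eq_sub, ← sub_smul, norm_smul, Real.norm_eq_abs]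
  -- The cells and the segment are bounded, so a lattice shift carrying a point of the segment into
  -- a cell has norm at most `R + R'`. Hence finitely many translated cells cover the segment.
  obtain ⟨R, hR⟩ : ∃ R : ℝ, ∀ K ∈ M.cells, ∀ w ∈ K, ‖w‖ ≤ R := by
    have hb : IsCompact (⋃ K ∈ M.cells, K) := M.cells.finite_toSet.isCompact_biUnion
      fun K hK => isCompact hK
    obtain ⟨R, hR⟩ := hb.exists_bound_of_continuousOn continuousOn_id
    exact ⟨R, fun K hK w hw => hR w (mem_biUnion hK hw)⟩
  obtain ⟨R', hR'⟩ := (isCompact_Icc (a := (0 : ℝ)) (b := 1)).exists_bound_of_continuousOn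
    hγ.continuousOn
  obtain ⟨N, hN⟩ := exists_nat_ge (R + R')
  set S : Set ((Fin 3 → ℤ) × M.cells) :=
    (Icc (fun _ => -(N : ℤ)) (fun _ => (N : ℤ))) ×ˢ univ
  have hS : S.Finite := (Set.finite_Icc _ _).prod Set.finite_univ
  have hcov : ∀ s ∈ Icc (0 : ℝ) 1, s ∈ ⋃ j ∈ S, {s | γ s + lattice j.1 ∈ j.2.1} := by
    intro s hs
    obtain ⟨K, hK, z, hz⟩ := M.covers (γ s)
    refine mem_biUnion (x := ((z, ⟨K, hK⟩) : (Fin 3 → ℤ) × M.cells)) ⟨?_, mem_univ _⟩ hz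
    have hzn : ‖lattice z‖ ≤ N := by
      have : lattice z = (γ s + lattice z) - γ s := by abel
      rw [this]
      exact (norm_sub_le _ _).trans ((add_le_add (hR K hK _ hz) (hR' s hs)).trans hN)
    have hzi : ∀ i, |z i| ≤ (N : ℤ) := fun i => by
      have := (norm_le_pi_norm (lattice z) i).trans hzn
      simp only [lattice, Real.norm_eq_abs] at this
      exact_mod_cast this
    exact ⟨fun i => (abs_le.1 (hzi i)).1, fun i => (abs_le.1 (hzi i)).2⟩
  -- A mean value inequality needing only the lower limit of right slopes: at each time it suffices
  -- to find nearby later points with slope below `r`.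
  have key := image_le_of_liminf_slope_right_le_deriv_boundary (a := 0) (b := 1)
    (f := fun s => f (γ s) - f (γ 0)) (B := fun s => L * dist x y * s)
    (B' := fun _ => L * dist x y) (by fun_prop) (by simp) (by fun_prop)
    (fun s _ => by simpa using ((hasDerivAt_id s).const_mul (L * dist x y)).hasDerivWithinAt) (by
      intro t ht r hr hcon
      -- An ultrafilter of times decreasing to `t` selects one of the finitely many translated
      -- cells. That cell is closed, so it also contains `γ t`, and the Lipschitz bound within this
      -- single cell contradicts `hcon`.
      set U := Ultrafilter.of (𝓝[>] t)
      have hU : (U : Filter ℝ) ≤ 𝓝[>] t := Ultrafilter.of_le _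
      have hU1 : Icc (0 : ℝ) 1 ∈ U := hU (by
        refine mem_of_superset (Ioo_mem_nhdsGT ht.2) fun s hs => ⟨ht.1.trans hs.1.le, hs.2.le⟩)
      have hU2 : (⋃ j ∈ S, {s | γ s + lattice j.1 ∈ j.2.1}) ∈ U := mem_of_superset hU1 hcov
      obtain ⟨⟨z, K, hK⟩, -, hj⟩ := (Ultrafilter.finite_biUnion_mem_iff hS).1 hU2
      have htK : γ t + lattice z ∈ K := by
        have hcl : IsClosed {s | γ s + lattice z ∈ K} :=
          (isCompact hK).isClosed.preimage (hγ.add continuous_const)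
        have ht' : t ∈ {s | γ s + lattice z ∈ K} := hcl.mem_of_tendsto (b := (U : Filter ℝ))
          (f := id) (hU.trans nhdsWithin_le_nhds) hj
        exact ht'
      obtain ⟨s, ⟨hs1, hs2⟩, hs3⟩ := (((show ∀ᶠ s in (U : Filter ℝ), _ from hU hcon).and
        (show ∀ᶠ s in (U : Filter ℝ), s ∈ Ioi t from hU self_mem_nhdsWithin)).and hj).exists
      have hs2 : t < s := hs2
      apply hs1
      have h1 := (h K hK).dist_le_mul _ hs3 _ htK
      rw [dist_add_right, hγd, hf, hf, abs_of_pos (sub_pos.2 hs2), Real.dist_eq] at h1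
      refine lt_of_le_of_lt ?_ hr
      rw [slope_def_field, div_le_iff₀ (sub_pos.2 hs2)]
      have := le_abs_self (f (γ s) - f (γ t))
      linarith)
  have := key (x := 1) (by simp)
  simpa [γ] using this

end PeriodicMesh

/-- A polynomial is Lipschitz on each compact convex cell; there are finitely many cells, and
continuity glues the bounds. -/
theorem Uh_torusLip {M : PeriodicMesh} {k : ℕ} {φ : Pt → Fin 3 → ℝ} (hφ : φ ∈ Uh M k) (i : Fin 3) :
    TorusLip (fun x => φ x i) := by
  have hper : IsPeriodic (fun x => φ x i) := hφ.2.1.comp (fun y => y i)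
  have hc : Continuous (fun x => φ x i) := (continuous_apply i).comp hφ.1
  have h : ∀ K : M.cells, ∃ L : ℝ≥0, LipschitzOnWith L (fun x => φ x i) K.1 := by
    rintro ⟨K, hK⟩
    obtain ⟨p, -, hp⟩ := hφ.2.2 K hK i
    obtain ⟨C, hC⟩ := (PeriodicMesh.isCompact hK).exists_bound_of_continuousOn
      ((contDiff_eval p).continuous_fderiv one_ne_zero).continuousOn
    have := (PeriodicMesh.convex hK).lipschitzOnWith_of_nnnorm_fderiv_le
      (f := fun x => MvPolynomial.eval x p) (C := ⟨max C 0, le_max_right _ _⟩)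
      (fun x _ => (contDiff_eval p).differentiable one_ne_zero x)
      (fun x hx => (hC x hx).trans (le_max_left _ _))
    exact ⟨_, fun x hx y hy => by simpa only [hp x hx, hp y hy] using this hx hy⟩
  choose L hL using h
  exact ⟨hper, Finset.univ.sup L, PeriodicMesh.lipschitzWith_of_cells hper hc fun K hK =>
    (hL ⟨K, hK⟩).weaken (Finset.le_sup (Finset.mem_univ _))⟩

/-! ### Cellwise polynomial functions -/

/-- `f` agrees a.e. on each cell with a polynomial of degree at most `d`. -/
def CellPoly (M : PeriodicMesh) (d : ℕ) (f : Pt → ℝ) : Prop :=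
  ∀ K ∈ M.cells, ∃ p : MvPolynomial (Fin 3) ℝ,
    p.totalDegree ≤ d ∧ ∀ᵐ x ∂(volume.restrict K), f x = MvPolynomial.eval x p

namespace CellPoly

variable {M : PeriodicMesh} {d e : ℕ} {f g : Pt → ℝ}

theorem mono (hf : CellPoly M d f) (h : d ≤ e) : CellPoly M e f := fun K hK => by
  obtain ⟨p, hp, hx⟩ := hf K hK
  exact ⟨p, hp.trans h, hx⟩

theorem const (c : ℝ) : CellPoly M d (fun _ => c) := fun _ _ =>
  ⟨MvPolynomial.C c, by simp, by simp⟩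

theorem add (hf : CellPoly M d f) (hg : CellPoly M d g) : CellPoly M d (fun x => f x + g x) :=
  fun K hK => by
  obtain ⟨p, hp, hpx⟩ := hf K hK
  obtain ⟨q, hq, hqx⟩ := hg K hK
  refine ⟨p + q, (MvPolynomial.totalDegree_add p q).trans (max_le hp hq), ?_⟩
  filter_upwards [hpx, hqx] with x h1 h2
  simp [h1, h2]

theorem mul (hf : CellPoly M d f) (hg : CellPoly M e g) :
    CellPoly M (d + e) (fun x => f x * g x) := fun K hK => by
  obtain ⟨p, hp, hpx⟩ := hf K hK
  obtain ⟨q, hq, hqx⟩ := hg K hK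
  refine ⟨p * q, (MvPolynomial.totalDegree_mul p q).trans (add_le_add hp hq), ?_⟩
  filter_upwards [hpx, hqx] with x h1 h2
  simp [h1, h2]

theorem const_mul (c : ℝ) (hf : CellPoly M d f) : CellPoly M d (fun x => c * f x) :=
  ((const (d := 0) c).mul hf).mono (by simp)

theorem sub (hf : CellPoly M d f) (hg : CellPoly M d g) : CellPoly M d (fun x => f x - g x) := by
  simpa [sub_eq_add_neg] using hf.add (hg.const_mul (-1))

theorem sum {ι : Type*} {s : Finset ι} {f : ι → Pt → ℝ} (hf : ∀ i ∈ s, CellPoly M d (f i)) :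
    CellPoly M d (fun x => ∑ i ∈ s, f i x) := by
  classical
  induction s using Finset.induction_on with
  | empty => simpa using const 0
  | insert a s ha ih =>
    simp only [Finset.sum_insert ha]
    exact (hf a (by simp)).add (ih fun i hi => hf i (by simp [hi]))

theorem memLp_top (hf : CellPoly M d f) (hp : IsPeriodic f) : MemLp f ⊤ volume := by
  have hb : ∀ K : M.cells, ∃ C : ℝ, ∀ᵐ x ∂(volume.restrict K.1), ‖f x‖ ≤ C := by
    rintro ⟨K, hK⟩
    obtain ⟨p, -, hx⟩ := hf K hK
    obtain ⟨C, hC⟩ := (PeriodicMesh.isCompact hK).exists_bound_of_continuousOn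
      (contDiff_eval p).continuous.continuousOn
    refine ⟨C, ?_⟩
    filter_upwards [hx, ae_restrict_mem (PeriodicMesh.measurableSet hK)] with x h1 h2
    rw [h1]
    exact hC x h2
  choose C hC using hb
  refine memLp_top_of_bound (PeriodicMesh.aestronglyMeasurable_of_cells (M := M) hp fun K hK => ?_)
    (∑ K, |C K|) (PeriodicMesh.ae_of_cells (M := M) (hp.comp fun y => ‖y‖ ≤ ∑ K, |C K|)
      fun K hK => ?_)
  · obtain ⟨p, -, hx⟩ := hf K hK
    exact (contDiff_eval p).continuous.aestronglyMeasurable.congr (hx.mono fun x h => h.symm)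
  · filter_upwards [hC ⟨K, hK⟩] with x hx
    exact hx.trans ((le_abs_self _).trans (Finset.single_le_sum (f := fun K => |C K|)
      (fun _ _ => abs_nonneg _) (Finset.mem_univ (⟨K, hK⟩ : M.cells))))

end CellPoly

theorem Uh_cellPoly_pd {M : PeriodicMesh} {k : ℕ} {φ : Pt → Fin 3 → ℝ} (hφ : φ ∈ Uh M k)
    (i α : Fin 3) : CellPoly M (k - 1) (pd α (fun x => φ x i)) := fun K hK => by
  obtain ⟨p, hp, hx⟩ := hφ.2.2 K hK i
  refine ⟨MvPolynomial.pderiv α p,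
    (totalDegree_pderiv_le α p).trans (Nat.sub_le_sub_right hp 1), ?_⟩
  -- The polynomial represents `φ` on `K` only, so it determines the derivative just in the
  -- interior, which is enough a.e.
  filter_upwards [PeriodicMesh.ae_mem_interior hK] with x hxK
  rw [← pd_eval, pd, pd]
  congr 1
  apply Filter.EventuallyEq.fderiv_eq
  filter_upwards [isOpen_interior.mem_nhds hxK] with y hy
  exact hx y (interior_subset hy)

theorem Hh_cellPoly {M : PeriodicMesh} {k : ℕ} {ψ : Pt → Xi} (hψ : ψ ∈ Hh M k) (A : Idx) :
    CellPoly M (degH k A) (fun x => ψ x A) := fun K hK => hψ.2 K hK A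

theorem Hh_memLp {M : PeriodicMesh} {k : ℕ} {ψ : Pt → Xi} (hψ : ψ ∈ Hh M k) (A : Idx) :
    MemLp (fun x => ψ x A) ⊤ volume :=
  (Hh_cellPoly hψ A).memLp_top (hψ.1.comp fun y => y A)

/-- The degree count behind the choice of `H_h`: the derivative of `Φ^A` has degree 0, 1 or 2 in
`F`, and both `F` and `f` have degree at most `k - 1`, which gives `k - 1`, `2(k - 1)`, `3(k - 1)`.
-/
theorem cellPoly_dPhi_mul {M : PeriodicMesh} {k : ℕ} {ψ : Pt → Xi} (hψ : ψ ∈ Hh M k)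
    {f : Pt → ℝ} (hf : CellPoly M (k - 1) f) (A : Idx) (i α : Fin 3) :
    CellPoly M (degH k A) (fun x => dPhi A i α (Fpart (ψ x)) * f x) := by
  have hF : ∀ j β, CellPoly M (k - 1) (fun x => Fpart (ψ x) j β) := fun j β =>
    Hh_cellPoly hψ (Sum.inl (j, β))
  rcases A with ⟨j, β⟩ | ⟨j, β⟩ | u
  · simp only [dPhi_F]
    exact hf.const_mul _
  · simp only [dPhi_Z]
    refine CellPoly.mono (CellPoly.mul (.sub (.sub (.add ((hF _ _).const_mul _)
      ((hF _ _).const_mul _)) ((hF _ _).const_mul _)) ((hF _ _).const_mul _)) hf) ?_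
    simp only [degH]; omega
  · simp only [dPhi_w]
    refine CellPoly.mono (CellPoly.mul (.sub ((hF _ _).mul (hF _ _)) ((hF _ _).mul (hF _ _))) hf) ?_
    simp only [degH]; omega

/-- The kinematic equation of the scheme holds a.e. -/
theorem IsDiscreteSolution.kinematic_ae {G : Xi → ℝ} {M : PeriodicMesh} {k : ℕ} {τ : ℝ}
    {V : ℕ → Pt → Fin 3 → ℝ} {X : ℕ → Pt → Xi} (h : IsDiscreteSolution G M k τ V X) (n : ℕ)
    (A : Idx) : ∀ᵐ x, (X (n + 1) x A - X n x A) / τ =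
      ∑ i, ∑ α, dPhi A i α (Fpart (X n x)) * pd α (fun y => V (n + 1) y i) x := by
  set Ψ : Pt → Xi := fun x A =>
    ∑ i, ∑ α, dPhi A i α (Fpart (X n x)) * pd α (fun y => V (n + 1) y i) x
  set δ : Pt → Xi := fun x A => (X (n + 1) x A - X n x A) / τ
  have hΨ : Ψ ∈ Hh M k := by
    refine ⟨fun z x => ?_, fun K hK A => ?_⟩
    · funext A
      simp only [Ψ, (h.mem_H n).1 z x]
      congr 1; ext i; congr 1; ext α
      rw [(((h.mem_U (n + 1)).2.1.comp fun y => y i).pd α) z x]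
    · exact CellPoly.sum (fun i _ => CellPoly.sum fun α _ =>
        cellPoly_dPhi_mul (h.mem_H n) (Uh_cellPoly_pd (h.mem_U (n + 1)) i α) A i α) K hK
  have hδ : δ ∈ Hh M k := by
    have : δ = (τ⁻¹ : ℝ) • (X (n + 1) - X n) := by
      ext x A; simp [δ, div_eq_inv_mul]
    rw [this]
    exact (Hh M k).smul_mem _ ((Hh M k).sub_mem (h.mem_H _) (h.mem_H _))
  have hψ : δ - Ψ ∈ Hh M k := (Hh M k).sub_mem hδ hΨ
  have hI : ∀ χ ∈ Hh M k, IntegrableOn (fun x => ∑ A, χ x A * (δ - Ψ) x A) unitCell := by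
    intro χ hχ
    refine integrable_finsetSum _ fun A _ => ?_
    have : IsFiniteMeasure (volume.restrict unitCell) :=
      isFiniteMeasure_restrict.2 isCompact_unitCell.measure_lt_top.ne
    exact ((((Hh_memLp hψ A).mul (Hh_memLp hχ A) (r := ⊤)).restrict unitCell).integrable le_top)
  -- Both sides of the equation lie in `H_h`, so their difference is an admissible test field and
  -- its `L²` norm vanishes.
  have h0 : ∫ x in unitCell, ∑ A, (δ - Ψ) x A * (δ - Ψ) x A = 0 := by
    have := h.kinematic n _ hψ
    rw [← sub_eq_zero, ← integral_sub (hI δ hδ) (hI Ψ hΨ)] at this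
    rw [← this]
    congr 1; ext x
    rw [← Finset.sum_sub_distrib]
    exact Finset.sum_congr rfl fun A _ => sub_mul _ _ _
  have hae := (setIntegral_eq_zero_iff_of_nonneg_ae (Filter.Eventually.of_forall
    fun x => Finset.sum_nonneg fun A _ => mul_self_nonneg _) (hI _ hψ)).1 h0
  refine IsPeriodic.ae_of_unitCell (p := fun x => δ x A = Ψ x A)
    ((hδ.1.comp fun y => y A).comp₂ (hΨ.1.comp fun y => y A) _) ?_
  filter_upwards [hae] with x hx
  have := (Finset.sum_eq_zero_iff_of_nonneg fun A _ => mul_self_nonneg _).1 hx A (Finset.mem_univ A)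
  simpa [sub_eq_zero] using this


/-! ### Weakly curl free matrix fields -/

/-- The rows of `F` are curl free in the sense of distributions. -/
def WeakCurlFree (F : Pt → Mat3) : Prop :=
  ∀ φ : Pt → ℝ, ContDiff ℝ (⊤ : ℕ∞) φ → HasCompactSupport φ → ∀ i β γ : Fin 3,
    ∫ x, F x i β * pd γ φ x = ∫ x, F x i γ * pd β φ x

theorem contDiff_pd {φ : Pt → ℝ} (hφ : ContDiff ℝ (⊤ : ℕ∞) φ) (α : Fin 3) :
    ContDiff ℝ (⊤ : ℕ∞) (pd α φ) :=
  (hφ.fderiv_right (m := (⊤ : ℕ∞)) (by simp)).clm_apply contDiff_const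

theorem continuous_pd {φ : Pt → ℝ} (hφ : ContDiff ℝ 1 φ) (α : Fin 3) : Continuous (pd α φ) :=
  (hφ.continuous_fderiv one_ne_zero).clm_apply continuous_const

theorem hasCompactSupport_pd {φ : Pt → ℝ} (hφ : HasCompactSupport φ) (α : Fin 3) :
    HasCompactSupport (pd α φ) := hφ.fderiv_apply (𝕜 := ℝ) _

theorem pd_comm {φ : Pt → ℝ} (hφ : ContDiff ℝ (⊤ : ℕ∞) φ) (α β : Fin 3) (x : Pt) :
    pd α (pd β φ) x = pd β (pd α φ) x := by
  have h2 : ContDiff ℝ 2 φ := mod_cast contDiff_infty.1 hφ 2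
  have hd : DifferentiableAt ℝ (fderiv ℝ φ) x :=
    (h2.fderiv_right (m := 1) (by norm_num)).differentiable one_ne_zero x
  have key : ∀ α β, pd α (pd β φ) x =
      fderiv ℝ (fderiv ℝ φ) x (Pi.single α 1) (Pi.single β 1) := by
    intro α β
    have h := (hd.hasFDerivAt.clm_apply (hasFDerivAt_const (Pi.single β 1 : Pt) x)).fderiv
    rw [pd]
    erw [h]
    simp
  rw [key, key]
  exact (h2.contDiffAt.isSymmSndFDerivAt (by simp)) _ _

theorem IsGradient.weakCurlFree {F : Pt → Mat3} (hF : IsGradient F) : WeakCurlFree F := by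
  obtain ⟨-, y, -, hy⟩ := hF
  intro φ hφ hc i β γ
  have h1 := hy (pd γ φ) (contDiff_pd hφ γ) (hasCompactSupport_pd hc γ) i β
  have h2 := hy (pd β φ) (contDiff_pd hφ β) (hasCompactSupport_pd hc β) i γ
  simp only [pd_comm hφ β γ] at h1
  linarith

theorem lipschitz_of_hasCompactSupport {φ : Pt → ℝ} (hφ : ContDiff ℝ 1 φ)
    (hc : HasCompactSupport φ) : ∃ C, LipschitzWith C φ := by
  obtain ⟨C, hC⟩ := (hc.fderiv (𝕜 := ℝ)).exists_bound_of_continuous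
    (hφ.continuous_fderiv one_ne_zero)
  exact ⟨⟨max C 0, le_max_right _ _⟩, lipschitzWith_of_nnnorm_fderiv_le
    (hφ.differentiable one_ne_zero) fun x => (hC x).trans (le_max_left _ _)⟩

theorem TorusLip.integral_pd_mul {f φ : Pt → ℝ} (hf : TorusLip f) (hφ : ContDiff ℝ 1 φ)
    (hc : HasCompactSupport φ) (α : Fin 3) :
    ∫ x, pd α f x * φ x = -∫ x, f x * pd α φ x := by
  obtain ⟨C, hC⟩ := hf.2
  obtain ⟨D, hD⟩ := lipschitz_of_hasCompactSupport hφ hc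
  have h := hC.integral_lineDeriv_mul_eq (μ := volume) hD hc (Pi.single α 1)
  rw [integral_congr_ae (g := fun x => lineDeriv ℝ f x (Pi.single α 1) * φ x), h, ← integral_neg]
  · congr 1; ext x
    rw [(hφ.differentiable one_ne_zero x).lineDeriv_eq_fderiv, map_neg, pd]
    ring
  · filter_upwards [hf.ae_pd_eq_lineDeriv α] with x hx
    rw [hx]

theorem MemLp.integrable_mul_of_hasCompactSupport {f φ : Pt → ℝ} (hf : MemLp f ⊤ volume)
    (hφ : Continuous φ) (hc : HasCompactSupport φ) : Integrable (fun x => f x * φ x) :=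
  (hφ.integrable_of_hasCompactSupport hc).mul_of_top_right hf

/-- The added gradient contributes `-τ ∫ g_i ∂_β∂_γ φ`, which is symmetric in `β` and `γ`. -/
theorem WeakCurlFree.add_grad {F F' : Pt → Mat3} (hF : WeakCurlFree F)
    (hb : ∀ i α, MemLp (fun x => F x i α) ⊤ volume) {g : Pt → Fin 3 → ℝ}
    (hg : ∀ i, TorusLip (fun x => g x i)) {τ : ℝ}
    (h : ∀ i α, ∀ᵐ x, F' x i α = F x i α + τ * pd α (fun y => g y i) x) : WeakCurlFree F' := by
  intro φ hφ hc i β γ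
  have h1 : ContDiff ℝ 1 φ := hφ.of_le (by exact_mod_cast le_top)
  have key : ∀ β γ, ∫ x, F' x i β * pd γ φ x =
      (∫ x, F x i β * pd γ φ x) - τ * ∫ x, g x i * pd β (pd γ φ) x := by
    intro β γ
    have hc1 := (continuous_pd h1 γ)
    have hc2 := hasCompactSupport_pd hc γ
    have h2 := (hg i).integral_pd_mul ((contDiff_pd hφ γ).of_le (by exact_mod_cast le_top)) hc2 β
    rw [integral_congr_ae (g := fun x => F x i β * pd γ φ x +
      τ * (pd β (fun y => g y i) x * pd γ φ x)), integral_add, integral_const_mul, h2]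
    · ring
    · exact MemLp.integrable_mul_of_hasCompactSupport (hb i β) hc1 hc2
    · exact (MemLp.integrable_mul_of_hasCompactSupport ((hg i).memLp_pd β) hc1 hc2).const_mul τ
    · filter_upwards [h i β] with x hx
      rw [hx]; ring
  rw [key, key, hF φ hφ hc i β γ]
  simp only [pd_comm hφ β γ]

/-! ### Mollification -/

/-- The mollification of `f` by the normalized bump function `ρ`. -/
noncomputable def mollify (ρ : ContDiffBump (0 : Pt)) (f : Pt → ℝ) (x : Pt) : ℝ :=
  ∫ t, f t * ρ.normed volume (x - t)

theorem mollify_eq (ρ : ContDiffBump (0 : Pt)) (f : Pt → ℝ) :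
    mollify ρ f = convolution f (ρ.normed volume) (ContinuousLinearMap.lsmul ℝ ℝ) volume := rfl

/-- The other order of convolution puts the kernel at `x - t`, which suits differentiation; this one
puts `f` there, which suits periodicity and a.e. convergence. -/
theorem mollify_eq' (ρ : ContDiffBump (0 : Pt)) (f : Pt → ℝ) :
    mollify ρ f = convolution (ρ.normed volume) f (ContinuousLinearMap.lsmul ℝ ℝ) volume := by
  ext x
  rw [convolution_lsmul_swap]
  exact integral_congr_ae (Eventually.of_forall fun t => mul_comm _ _)

section mollify

variable (ρ : ContDiffBump (0 : Pt)) {f : Pt → ℝ}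

theorem contDiff_mollify (hf : LocallyIntegrable f) : ContDiff ℝ 1 (mollify ρ f) := by
  rw [mollify_eq]
  exact ρ.hasCompactSupport_normed.contDiff_convolution_right _ hf (ρ.contDiff_normed (n := 1))

/-- The derivative falls on the kernel, so differentiating a mollification at `x` is testing `f`
against the reflected bump `y ↦ ρ(x - y)`; this carries weak curl-freeness over to the mollified
field. -/
theorem pd_mollify (hf : LocallyIntegrable f) (α : Fin 3) (x : Pt) :
    pd α (mollify ρ f) x = -∫ t, f t * pd α (fun y => ρ.normed volume (x - y)) t := by
  have h1 : ContDiff ℝ 1 (ρ.normed (volume : Measure Pt)) := ρ.contDiff_normed (n := 1)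
  have h := ρ.hasCompactSupport_normed.hasFDerivAt_convolution_right
    (ContinuousLinearMap.lsmul ℝ ℝ) hf h1 x
  rw [pd, mollify_eq, h.fderiv, convolution_precompR_apply _ hf
    (ρ.hasCompactSupport_normed.fderiv (𝕜 := ℝ)) (h1.continuous_fderiv one_ne_zero),
    convolution_def, ← integral_neg]
  congr 1; ext t
  have : pd α (fun y => ρ.normed volume (x - y)) t =
      -(fderiv ℝ (ρ.normed volume) (x - t) (Pi.single α 1)) := by
    have hs : HasFDerivAt (fun y : Pt => x - y) (-ContinuousLinearMap.id ℝ Pt) t :=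
      (hasFDerivAt_id t).const_sub x
    have := ((h1.differentiable one_ne_zero (x - t)).hasFDerivAt.comp t hs).fderiv
    rw [pd]
    erw [this]
    simp
  rw [this]
  simp

theorem IsPeriodic.mollify (hf : IsPeriodic f) : IsPeriodic (mollify ρ f) := by
  intro z x
  rw [mollify_eq', convolution_def, convolution_def]
  congr 1; ext t
  rw [show x + lattice z - t = (x - t) + lattice z by abel, hf]

theorem norm_mollify_le {C : ℝ} (hf : ∀ᵐ x, ‖f x‖ ≤ C) (x : Pt) : ‖Elasto.mollify ρ f x‖ ≤ C := by
  have h1 : Integrable (fun t => C * ρ.normed (volume : Measure Pt) (x - t)) :=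
    (ρ.integrable_normed.comp_sub_left x).const_mul C
  have h2 : ∫ t, C * ρ.normed (volume : Measure Pt) (x - t) = C := by
    rw [integral_const_mul, integral_sub_left_eq_self (ρ.normed volume) volume x,
      ρ.integral_normed, mul_one]
  refine (norm_integral_le_of_norm_le h1 ?_).trans h2.le
  filter_upwards [hf] with t ht
  rw [norm_mul, Real.norm_of_nonneg (ρ.nonneg_normed _)]
  exact mul_le_mul_of_nonneg_right ht (ρ.nonneg_normed _)

theorem WeakCurlFree.pd_mollify_comm {F : Pt → Mat3} (hF : WeakCurlFree F)
    (hl : ∀ i α, LocallyIntegrable (fun x => F x i α)) (i β γ : Fin 3) (x : Pt) :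
    pd γ (Elasto.mollify ρ (fun y => F y i β)) x =
      pd β (Elasto.mollify ρ (fun y => F y i γ)) x := by
  rw [pd_mollify ρ (hl _ _), pd_mollify ρ (hl _ _), hF]
  · exact (ρ.contDiff_normed (n := ⊤)).comp (contDiff_const.sub contDiff_id)
  · exact ρ.hasCompactSupport_normed.comp_homeomorph (Homeomorph.subLeft x)

end mollify

theorem exists_mollifiers : ∃ ρ : ℕ → ContDiffBump (0 : Pt), ∀ f : Pt → ℝ, LocallyIntegrable f →
    ∀ᵐ x, Tendsto (fun n => mollify (ρ n) f x) atTop (𝓝 (f x)) := by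
  have hp : ∀ n : ℕ, (0 : ℝ) < 1 / (n + 1) := fun n => Nat.one_div_pos_of_nat
  -- The ratio of outer to inner radius stays equal to 2, as the a.e. convergence theorem requires a
  -- uniform bound on it.
  refine ⟨fun n => ⟨1 / (n + 1), 2 * (1 / (n + 1)), hp n, by linarith [hp n]⟩, fun f hf => ?_⟩
  simp only [mollify_eq']
  refine ContDiffBump.ae_convolution_tendsto_right_of_locallyIntegrable (K := 2) ?_
    (Eventually.of_forall fun n => le_rfl) hf
  simpa using (tendsto_one_div_add_atTop_nhds_zero_nat (𝕜 := ℝ)).const_mul 2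

theorem contDiff_mat {F : Pt → Mat3} {n : WithTop ℕ∞}
    (h : ∀ i α, ContDiff ℝ n (fun x => F x i α)) : ContDiff ℝ n F :=
  contDiff_pi.2 fun i => contDiff_pi.2 fun α => h i α

theorem exists_ae_bound {f : Pt → ℝ} (hf : MemLp f ⊤ volume) : ∃ C, ∀ᵐ x, ‖f x‖ ≤ C := by
  have h := hf.2
  rw [eLpNorm_exponent_top] at h
  refine ⟨(eLpNormEssSup f volume).toReal, ?_⟩
  filter_upwards [ae_le_eLpNormEssSup (f := f) (μ := volume)] with x hx
  rw [← toReal_enorm]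
  exact ENNReal.toReal_mono h.ne hx

/-- The weak form of the null Lagrangian identity `∂_α (Φ^A_{,iα}(F)) = 0`. -/
theorem WeakCurlFree.setIntegral_dPhi_mul_pd {F : Pt → Mat3} (hF : WeakCurlFree F)
    (hp : IsPeriodic F) (hb : ∀ i α, MemLp (fun x => F x i α) ⊤ volume) {ψ : Pt → ℝ}
    (hψ : TorusLip ψ) (A : Idx) (i : Fin 3) :
    ∫ x in unitCell, ∑ α, dPhi A i α (F x) * pd α ψ x = 0 := by
  obtain ⟨ρ, hρ⟩ := exists_mollifiers
  have hl : ∀ i α, LocallyIntegrable (fun x => F x i α) := fun i α =>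
    (hb i α).locallyIntegrable le_top
  set Fn : ℕ → Pt → Mat3 := fun n x i α => mollify (ρ n) (fun y => F y i α) x
  have hFn : ∀ n, ContDiff ℝ 1 (Fn n) := fun n => contDiff_mat fun i α => contDiff_mollify _ (hl i α)
  have hFp : ∀ n, IsPeriodic (Fn n) := fun n z x => by
    funext i α
    exact (hp.comp fun y => y i α).mollify (ρ n) z x
  have hT : ∀ n α, TorusLip (fun x => dPhi A i α (Fn n x)) := fun n α =>
    TorusLip.of_contDiff ((hFp n).comp _)
      (((contDiff_dPhi A i α).of_le (by norm_num)).comp (hFn n))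
  have hfin : IsFiniteMeasure (volume.restrict unitCell) :=
    isFiniteMeasure_restrict.2 isCompact_unitCell.measure_lt_top.ne
  have hI : ∀ f : Pt → ℝ, MemLp f ⊤ (volume : Measure Pt) → IntegrableOn f unitCell := fun f hf =>
    (hf.restrict unitCell).integrable le_top
  -- For the smooth curl-free field the integrand is a.e. the divergence of `α ↦ dPhi A i α (Fn n) *
  -- ψ`, which integrates to zero over the torus.
  have h0 : ∀ n, ∫ x in unitCell, ∑ α, dPhi A i α (Fn n x) * pd α ψ x = 0 := by
    intro n
    have h1 : ∀ α, TorusLip (fun x => dPhi A i α (Fn n x) * ψ x) := fun α => (hT n α).mul hψ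
    have h2 : ∫ x in unitCell, ∑ α, pd α (fun x => dPhi A i α (Fn n x) * ψ x) x = 0 := by
      rw [integral_finsetSum _ fun α _ => hI _ ((h1 α).memLp_pd α)]
      exact Finset.sum_eq_zero fun α _ => (h1 α).setIntegral_pd α
    rw [← h2]
    refine setIntegral_congr_ae measurableSet_unitCell ?_
    filter_upwards [hψ.ae_differentiableAt] with x hx _
    have h3 : ∀ α, pd α (fun x => dPhi A i α (Fn n x) * ψ x) x =
        dPhi A i α (Fn n x) * pd α ψ x + pd α (fun x => dPhi A i α (Fn n x)) x * ψ x := by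
      intro α
      have hd : DifferentiableAt ℝ (fun x => dPhi A i α (Fn n x)) x :=
        (((contDiff_dPhi A i α).of_le (by norm_num : (1 : WithTop ℕ∞) ≤ 2)).comp
          (hFn n)).differentiable one_ne_zero x
      have := (hd.hasFDerivAt.mul hx.hasFDerivAt).fderiv
      rw [pd]
      erw [this]
      simp only [add_apply, smul_apply, smul_eq_mul, pd]
      ring
    simp only [h3, Finset.sum_add_distrib, ← Finset.sum_mul]
    rw [sum_pd_dPhi_eq_zero ((hFn n).differentiable one_ne_zero x), zero_mul, add_zero]
    exact fun j β γ => hF.pd_mollify_comm (ρ n) hl j β γ x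
  -- Averaging does not increase the essential bound, so all mollified fields stay in one compact
  -- ball; there `dPhi` is bounded, which supplies the dominating function.
  have hbd : ∃ C : ℝ, ∀ n x, ‖Fn n x‖ ≤ C := by
    choose C hC using fun i α => exists_ae_bound (hb i α)
    have hC0 : ∀ i α, 0 ≤ C i α := fun i α => by
      obtain ⟨x, hx⟩ := (hC i α).exists
      exact (norm_nonneg _).trans hx
    refine ⟨∑ i, ∑ α, C i α, fun n x => ?_⟩
    have hs : 0 ≤ ∑ i, ∑ α, C i α := Finset.sum_nonneg fun i _ => Finset.sum_nonneg fun α _ => hC0 i α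
    refine (pi_norm_le_iff_of_nonneg hs).2 fun i => (pi_norm_le_iff_of_nonneg hs).2 fun α => ?_
    refine (norm_mollify_le (ρ n) (hC i α) x).trans ?_
    refine (Finset.single_le_sum (f := C i) (fun α _ => hC0 i α) (Finset.mem_univ α)).trans ?_
    exact Finset.single_le_sum (f := fun i => ∑ α, C i α)
      (fun i _ => Finset.sum_nonneg fun α _ => hC0 i α) (Finset.mem_univ i)
  obtain ⟨C, hC⟩ := hbd
  have hB : ∀ α, ∃ B, ∀ n x, ‖dPhi A i α (Fn n x)‖ ≤ B := fun α => by
    obtain ⟨B, hB⟩ := (isCompact_closedBall (0 : Mat3) C).exists_bound_of_continuousOn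
      (contDiff_dPhi A i α).continuous.continuousOn
    exact ⟨B, fun n x => hB _ (by simpa using hC n x)⟩
  choose B hB using hB
  refine tendsto_nhds_unique (tendsto_integral_of_dominated_convergence
    (F := fun n x => ∑ α, dPhi A i α (Fn n x) * pd α ψ x)
    (fun x => ∑ α, B α * ‖pd α ψ x‖) ?_ ?_ ?_ ?_) (tendsto_const_nhds.congr fun n => (h0 n).symm)
  · intro n
    refine (integrable_finsetSum _ fun α _ => ?_).aestronglyMeasurable
    have hD : MemLp (fun x => dPhi A i α (Fn n x)) ⊤ volume := memLp_top_of_bound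
      (hT n α).continuous.aestronglyMeasurable (B α) (Eventually.of_forall (hB α n))
    exact hI _ ((hψ.memLp_pd α).mul hD)
  · exact integrable_finsetSum _ fun α _ => ((hI _ (hψ.memLp_pd α)).norm).const_mul _
  · refine fun n => Eventually.of_forall fun x => (norm_sum_le _ _).trans ?_
    refine Finset.sum_le_sum fun α _ => ?_
    rw [norm_mul]
    exact mul_le_mul_of_nonneg_right (hB α n x) (norm_nonneg _)
  · refine ae_restrict_of_ae ?_
    have : ∀ᵐ x, ∀ i α, Tendsto (fun n => Fn n x i α) atTop (𝓝 (F x i α)) :=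
      ae_all_iff.2 fun i => ae_all_iff.2 fun α => hρ _ (hl i α)
    filter_upwards [this] with x hx
    have hx' : Tendsto (fun n => Fn n x) atTop (𝓝 (F x)) :=
      tendsto_pi_nhds.2 fun i => tendsto_pi_nhds.2 fun α => hx i α
    exact tendsto_finsetSum _ fun α _ =>
      (((contDiff_dPhi A i α).continuous.tendsto _).comp hx').mul_const _


/-! ### Calculus rules and the nonconservative form of the exact system. -/

theorem pd_mul {f g : Pt → ℝ} {x : Pt} (hf : DifferentiableAt ℝ f x) (hg : DifferentiableAt ℝ g x)
    (α : Fin 3) : pd α (fun y => f y * g y) x = pd α f x * g x + f x * pd α g x := by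
  have := (hf.hasFDerivAt.fun_mul hg.hasFDerivAt).fderiv
  rw [pd, this]
  simp only [add_apply, smul_apply, smul_eq_mul, pd]
  ring

theorem pd_sub {f g : Pt → ℝ} {x : Pt} (hf : DifferentiableAt ℝ f x) (hg : DifferentiableAt ℝ g x)
    (α : Fin 3) : pd α (fun y => f y - g y) x = pd α f x - pd α g x := by
  have := (hf.hasFDerivAt.fun_sub hg.hasFDerivAt).fderiv
  rw [pd, this]
  rfl

theorem pd_sum {ι : Type*} {s : Finset ι} {f : ι → Pt → ℝ} {x : Pt}
    (hf : ∀ i ∈ s, DifferentiableAt ℝ (f i) x) (α : Fin 3) :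
    pd α (fun y => ∑ i ∈ s, f i y) x = ∑ i ∈ s, pd α (f i) x := by
  simp only [pd]
  rw [fderiv_fun_sum hf, sum_apply]

theorem contDiff_dG {G : Xi → ℝ} (hG : ContDiff ℝ 2 G) (A : Idx) : ContDiff ℝ 1 (dG G A) :=
  (hG.fderiv_right (m := 1) (by norm_num)).clm_apply contDiff_const

namespace IsSmoothSolution

variable {G : Xi → ℝ} {T : ℝ} {v : ℝ → Pt → Fin 3 → ℝ} {ξ : ℝ → Pt → Xi}

theorem contDiff_v (h : IsSmoothSolution G T v ξ) {t : ℝ} (ht : t ∈ Icc 0 T) :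
    ContDiff ℝ 1 (v t) := by
  rw [← contDiffOn_univ]
  exact h.smooth_v.comp (f := fun x : Pt => (t, x)) (by fun_prop) fun x _ => ⟨ht, mem_univ _⟩

theorem contDiff_ξ (h : IsSmoothSolution G T v ξ) {t : ℝ} (ht : t ∈ Icc 0 T) :
    ContDiff ℝ 1 (ξ t) := by
  rw [← contDiffOn_univ]
  exact h.smooth_ξ.comp (f := fun x : Pt => (t, x)) (by fun_prop) fun x _ => ⟨ht, mem_univ _⟩

theorem torusLip_v (h : IsSmoothSolution G T v ξ) {t : ℝ} (ht : t ∈ Icc 0 T) (i : Fin 3) :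
    TorusLip (fun x => v t x i) :=
  TorusLip.of_contDiff ((h.periodic_v t ht).comp fun y => y i)
    ((contDiff_apply ℝ ℝ i).comp (h.contDiff_v ht))

theorem torusLip_ξ (h : IsSmoothSolution G T v ξ) {t : ℝ} (ht : t ∈ Icc 0 T) (A : Idx) :
    TorusLip (fun x => ξ t x A) :=
  TorusLip.of_contDiff ((h.periodic_ξ t ht).comp fun y => y A)
    ((contDiff_apply ℝ ℝ A).comp (h.contDiff_ξ ht))

theorem contDiffOn_Ioo (h : IsSmoothSolution G T v ξ) :
    ContDiffOn ℝ 1 (fun p : ℝ × Pt => ξ p.1 p.2) (Ioo 0 T ×ˢ univ) :=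
  h.smooth_ξ.mono (prod_mono Ioo_subset_Icc_self subset_rfl)

theorem hasDerivAt_ξ (h : IsSmoothSolution G T v ξ) {t : ℝ} (ht : t ∈ Ioo 0 T) (x : Pt) :
    HasDerivAt (fun s => ξ s x) (fderiv ℝ (fun p : ℝ × Pt => ξ p.1 p.2) (t, x) (1, 0)) t := by
  have hd : DifferentiableAt ℝ (fun p : ℝ × Pt => ξ p.1 p.2) (t, x) :=
    (h.smooth_ξ.contDiffAt (prod_mem_nhds (Icc_mem_nhds ht.1 ht.2) univ_mem)).differentiableAt
      one_ne_zero
  exact hd.hasFDerivAt.comp_hasDerivAt t ((hasDerivAt_id t).prodMk (hasDerivAt_const t x))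

theorem hasDerivAt_v (h : IsSmoothSolution G T v ξ) {t : ℝ} (ht : t ∈ Ioo 0 T) (x : Pt) :
    HasDerivAt (fun s => v s x) (fderiv ℝ (fun p : ℝ × Pt => v p.1 p.2) (t, x) (1, 0)) t := by
  have hd : DifferentiableAt ℝ (fun p : ℝ × Pt => v p.1 p.2) (t, x) :=
    (h.smooth_v.contDiffAt (prod_mem_nhds (Icc_mem_nhds ht.1 ht.2) univ_mem)).differentiableAt
      one_ne_zero
  exact hd.hasFDerivAt.comp_hasDerivAt t ((hasDerivAt_id t).prodMk (hasDerivAt_const t x))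

/-- The coefficients of the `F`-block are constant, so no null Lagrangian identity is needed here.
Curl-freeness of `F` can thus be derived first without circularity. -/
theorem deriv_F (h : IsSmoothSolution G T v ξ) {t : ℝ} (ht : t ∈ Ioo 0 T) (x : Pt)
    (i β : Fin 3) : deriv (fun s => ξ s x (Sum.inl (i, β))) t = pd β (fun y => v t y i) x := by
  rw [h.kinematic t ht x]
  simp only [dPhi_F, ite_mul, one_mul, zero_mul]
  rw [Finset.sum_eq_single β]
  · simp
  · intro α _ hα
    simp [hα, pd]
  · simp

theorem hasDerivAt_integral (h : IsSmoothSolution G T v ξ) {t : ℝ} (ht : t ∈ Ioo 0 T)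
    {χ : Pt → ℝ} (hχ : Continuous χ) (hc : HasCompactSupport χ) (i β : Fin 3) :
    HasDerivAt (fun s => ∫ x, ξ s x (Sum.inl (i, β)) * χ x)
      (∫ x, pd β (fun y => v t y i) x * χ x) t := by
  set A : Idx := Sum.inl (i, β)
  set f' : ℝ → Pt → ℝ := fun s x => fderiv ℝ (fun p : ℝ × Pt => ξ p.1 p.2) (s, x) (1, 0) A
  have hf' : ∀ s ∈ Ioo 0 T, ∀ x, HasDerivAt (fun s => ξ s x A) (f' s x) s := fun s hs x =>
    hasDerivAt_pi.1 (h.hasDerivAt_ξ hs x) A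
  have hcont : ContinuousOn (fun p : ℝ × Pt => f' p.1 p.2) (Ioo 0 T ×ˢ univ) := by
    have h1 := h.contDiffOn_Ioo.continuousOn_fderiv_of_isOpen (isOpen_Ioo.prod isOpen_univ) le_rfl
    exact (continuous_apply A).comp_continuousOn (h1.clm_apply continuousOn_const)
  obtain ⟨ε, hε, hball⟩ := Metric.nhds_basis_closedBall.mem_iff.1 (Ioo_mem_nhds ht.1 ht.2)
  obtain ⟨C, hC⟩ := ((isCompact_closedBall t ε).prod hc.isCompact).exists_bound_of_continuousOn
    (hcont.mono (prod_mono hball (subset_univ _)))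
  have hF : ∀ s ∈ Ioo 0 T, Integrable (fun x => ξ s x A * χ x) := fun s hs => by
    have h1 := (h.torusLip_ξ (Ioo_subset_Icc_self hs) A).continuous.mul hχ
    exact h1.integrable_of_hasCompactSupport hc.mul_left
  have hslice : Continuous (fun x => f' t x) := by
    rw [← continuousOn_univ]
    exact hcont.comp (f := fun x : Pt => (t, x)) (by fun_prop) fun x _ => ⟨ht, mem_univ _⟩
  have key := (hasDerivAt_integral_of_dominated_loc_of_deriv_le (μ := (volume : Measure Pt))
    (F := fun s x => ξ s x A * χ x) (F' := fun s x => f' s x * χ x) (x₀ := t)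
    (bound := fun x => C * ‖χ x‖) (s := Metric.closedBall t ε)
    (Metric.closedBall_mem_nhds t hε) ?_ (hF t ht) ?_ ?_ ?_ ?_).2
  · have : ∀ x, f' t x = pd β (fun y => v t y i) x := fun x => by
      rw [← h.deriv_F ht, (hf' t ht x).deriv]
    simpa only [this] using key
  · filter_upwards [Ioo_mem_nhds ht.1 ht.2] with s hs
    exact (hF s hs).aestronglyMeasurable
  · exact (hslice.mul hχ).aestronglyMeasurable
  · refine Eventually.of_forall fun x s hs => ?_
    by_cases hx : x ∈ tsupport χ
    · rw [norm_mul]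
      exact mul_le_mul_of_nonneg_right (hC (s, x) ⟨hs, hx⟩) (norm_nonneg _)
    · simp [image_eq_zero_of_notMem_tsupport hx]
  · exact ((hχ.integrable_of_hasCompactSupport hc).norm).const_mul C
  · exact Eventually.of_forall fun x s hs => (hf' s (hball hs) x).mul_const _

/-- The curl tested against a fixed `φ` has zero time derivative on `(0,T)`, since `∂_t F = ∇v`.
Continuity up to `t = 0` connects it with the initial gradient. -/
theorem weakCurlFree (h : IsSmoothSolution G T v ξ) (h0 : IsGradient (fun x => Fpart (ξ 0 x)))
    {t : ℝ} (ht : t ∈ Ioo 0 T) : WeakCurlFree (fun x => Fpart (ξ t x)) := by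
  intro φ hφ hc i β γ
  have h1 : ContDiff ℝ 1 φ := hφ.of_le (by exact_mod_cast le_top)
  set c : ℝ → ℝ := fun s => (∫ x, ξ s x (Sum.inl (i, β)) * pd γ φ x) -
    ∫ x, ξ s x (Sum.inl (i, γ)) * pd β φ x
  have hc0 : c 0 = 0 := sub_eq_zero.2 (h0.weakCurlFree φ hφ hc i β γ)
  have hcont : ∀ (A : Idx) (α : Fin 3),
      ContinuousOn (fun s => ∫ x, ξ s x A * pd α φ x) (Icc 0 T) := by
    intro A α
    refine continuousOn_integral_of_compact_support (hasCompactSupport_pd hc α).isCompact ?_ ?_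
    · exact ((continuous_apply A).comp_continuousOn h.smooth_ξ.continuousOn).mul
        ((continuous_pd h1 α).comp continuous_snd).continuousOn
    · intro s x _ hx
      simp [image_eq_zero_of_notMem_tsupport hx]
  have hderiv : ∀ s ∈ Ioo 0 T, HasDerivAt c 0 s := by
    intro s hs
    have hd := (h.hasDerivAt_integral hs (continuous_pd h1 γ) (hasCompactSupport_pd hc γ) i β).sub
      (h.hasDerivAt_integral hs (continuous_pd h1 β) (hasCompactSupport_pd hc β) i γ)
    have hv := h.torusLip_v (Ioo_subset_Icc_self hs) i
    rw [hv.integral_pd_mul ((contDiff_pd hφ γ).of_le (by exact_mod_cast le_top))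
      (hasCompactSupport_pd hc γ), hv.integral_pd_mul
      ((contDiff_pd hφ β).of_le (by exact_mod_cast le_top)) (hasCompactSupport_pd hc β)] at hd
    simp only [pd_comm hφ β γ, sub_self] at hd
    exact hd
  obtain ⟨s, hs, hsl⟩ := exists_hasDerivAt_eq_slope c (fun _ => 0) ht.1
    (((hcont _ γ).sub (hcont _ β)).mono (Icc_subset_Icc_right ht.2.le))
    fun s hs => hderiv s ⟨hs.1, hs.2.trans ht.2⟩
  rw [hc0, sub_zero, sub_zero] at hsl
  have : c t = 0 := by
    rcases div_eq_zero_iff.1 hsl.symm with h | h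
    · exact h
    · exact absurd h ht.1.ne'
  exact sub_eq_zero.1 this

/-- The curl is continuous in `x` and vanishes as a distribution, hence everywhere. -/
theorem curl_free (h : IsSmoothSolution G T v ξ) (h0 : IsGradient (fun x => Fpart (ξ 0 x)))
    {t : ℝ} (ht : t ∈ Ioo 0 T) (x : Pt) (i β γ : Fin 3) :
    pd γ (fun y => Fpart (ξ t y) i β) x = pd β (fun y => Fpart (ξ t y) i γ) x := by
  have hC : ∀ A, ContDiff ℝ 1 (fun y => ξ t y A) := fun A =>
    (contDiff_apply ℝ ℝ A).comp (h.contDiff_ξ (Ioo_subset_Icc_self ht))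
  have hL := fun A => h.torusLip_ξ (Ioo_subset_Icc_self ht) A
  have hcont : ∀ A α, Continuous (pd α (fun y => ξ t y A)) := fun A α => continuous_pd (hC A) α
  have hz := ae_eq_zero_of_integral_contDiff_smul_eq_zero (μ := (volume : Measure Pt))
    (f := fun x => pd γ (fun y => ξ t y (Sum.inl (i, β))) x -
      pd β (fun y => ξ t y (Sum.inl (i, γ))) x)
    ((hcont _ γ).sub (hcont _ β)).locallyIntegrable (by
      intro φ hφ hc
      have h1 : ContDiff ℝ 1 φ := hφ.of_le (by exact_mod_cast le_top)
      have hI : ∀ A α, Integrable (fun x => pd α (fun y => ξ t y A) x * φ x) := fun A α =>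
        ((hcont A α).mul h1.continuous).integrable_of_hasCompactSupport hc.mul_left
      simp only [smul_eq_mul, mul_comm (φ _), sub_mul]
      rw [integral_sub (hI _ _) (hI _ _), (hL _).integral_pd_mul h1 hc,
        (hL _).integral_pd_mul h1 hc]
      have := h.weakCurlFree h0 ht φ hφ hc i β γ
      simp only [Fpart] at this
      rw [this, sub_self])
  have hz' := (((hcont _ γ).sub (hcont _ β)).ae_eq_iff_eq volume continuous_const).1 hz
  exact sub_eq_zero.1 (congrFun hz' x)

theorem contDiff_Fpart (h : IsSmoothSolution G T v ξ) {t : ℝ} (ht : t ∈ Icc 0 T) :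
    ContDiff ℝ 1 (fun x => Fpart (ξ t x)) :=
  contDiff_mat fun i α => (contDiff_apply ℝ ℝ (Sum.inl (i, α))).comp (h.contDiff_ξ ht)

theorem momentum_eq (h : IsSmoothSolution G T v ξ) (hG : ContDiff ℝ 2 G)
    (h0 : IsGradient (fun x => Fpart (ξ 0 x))) {t : ℝ} (ht : t ∈ Ioo 0 T) (x : Pt) (i : Fin 3) :
    deriv (fun s => v s x i) t =
      ∑ A, ∑ α, pd α (fun y => dG G A (ξ t y)) x * dPhi A i α (Fpart (ξ t x)) := by
  have ht' := Ioo_subset_Icc_self ht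
  have hg : ∀ A, DifferentiableAt ℝ (fun y => dG G A (ξ t y)) x := fun A =>
    ((contDiff_dG hG A).comp (h.contDiff_ξ ht')).differentiable one_ne_zero x
  have hΦ : ∀ A α, DifferentiableAt ℝ (fun y => dPhi A i α (Fpart (ξ t y))) x := fun A α =>
    (((contDiff_dPhi A i α).of_le (by norm_num : (1 : WithTop ℕ∞) ≤ 2)).comp
      (h.contDiff_Fpart ht')).differentiable one_ne_zero x
  rw [h.momentum t ht, Finset.sum_comm]
  have key : ∀ α, pd α (fun y => ∑ A, dG G A (ξ t y) * dPhi A i α (Fpart (ξ t y))) x =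
      ∑ A, (pd α (fun y => dG G A (ξ t y)) x * dPhi A i α (Fpart (ξ t x)) +
        dG G A (ξ t x) * pd α (fun y => dPhi A i α (Fpart (ξ t y))) x) := by
    intro α
    rw [pd_sum fun A _ => (hg A).fun_mul (hΦ A α)]
    exact Finset.sum_congr rfl fun A _ => pd_mul (hg A) (hΦ A α) α
  simp only [key, Finset.sum_add_distrib]
  -- The product rule leaves `G_{,A}(ξ) ∂_α(Φ^A_{,iα}(F))`, which the null Lagrangian identity
  -- removes.
  rw [add_eq_left, Finset.sum_comm]
  refine Finset.sum_eq_zero fun A _ => ?_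
  rw [← Finset.mul_sum, sum_pd_dPhi_eq_zero ((h.contDiff_Fpart ht').differentiable one_ne_zero x)
    (h.curl_free h0 ht x), mul_zero]

theorem kinematic_eq (h : IsSmoothSolution G T v ξ)
    (h0 : IsGradient (fun x => Fpart (ξ 0 x))) {t : ℝ} (ht : t ∈ Ioo 0 T) (x : Pt) (A : Idx) :
    deriv (fun s => ξ s x A) t =
      ∑ i, ∑ α, dPhi A i α (Fpart (ξ t x)) * pd α (fun y => v t y i) x := by
  have ht' := Ioo_subset_Icc_self ht
  have hv : ∀ i, DifferentiableAt ℝ (fun y => v t y i) x := fun i =>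
    ((contDiff_apply ℝ ℝ i).comp (h.contDiff_v ht')).differentiable one_ne_zero x
  have hΦ : ∀ i α, DifferentiableAt ℝ (fun y => dPhi A i α (Fpart (ξ t y))) x := fun i α =>
    (((contDiff_dPhi A i α).of_le (by norm_num : (1 : WithTop ℕ∞) ≤ 2)).comp
      (h.contDiff_Fpart ht')).differentiable one_ne_zero x
  rw [h.kinematic t ht, Finset.sum_comm (γ := Fin 3) (s := Finset.univ)]
  have key : ∀ α, pd α (fun y => ∑ i, dPhi A i α (Fpart (ξ t y)) * v t y i) x =
      ∑ i, (pd α (fun y => dPhi A i α (Fpart (ξ t y))) x * v t x i +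
        dPhi A i α (Fpart (ξ t x)) * pd α (fun y => v t y i) x) := by
    intro α
    rw [pd_sum fun i _ => (hΦ i α).fun_mul (hv i)]
    exact Finset.sum_congr rfl fun i _ => pd_mul (hΦ i α) (hv i) α
  simp only [key, Finset.sum_add_distrib]
  rw [add_eq_right, Finset.sum_comm]
  refine Finset.sum_eq_zero fun i _ => ?_
  rw [← Finset.sum_mul, sum_pd_dPhi_eq_zero ((h.contDiff_Fpart ht').differentiable one_ne_zero x)
    (h.curl_free h0 ht x), zero_mul]

end IsSmoothSolution


/-! ### Essentially bounded functions -/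

section bounded

variable {f g : Pt → ℝ}

theorem TorusLip.memLp_top (hf : TorusLip f) : MemLp f ⊤ volume := by
  obtain ⟨C, hC⟩ := hf.1.exists_bound hf.continuous
  exact memLp_top_of_bound hf.continuous.aestronglyMeasurable C (Eventually.of_forall hC)

theorem memLp_top_mul (hf : MemLp f ⊤ volume) (hg : MemLp g ⊤ volume) :
    MemLp (fun x => f x * g x) ⊤ volume := hg.mul hf

theorem memLp_top_add (hf : MemLp f ⊤ volume) (hg : MemLp g ⊤ volume) :
    MemLp (fun x => f x + g x) ⊤ volume := hf.add hg

theorem memLp_top_sub (hf : MemLp f ⊤ volume) (hg : MemLp g ⊤ volume) :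
    MemLp (fun x => f x - g x) ⊤ volume := hf.sub hg

theorem memLp_top_sum {ι : Type*} [Fintype ι] {f : ι → Pt → ℝ} (hf : ∀ i, MemLp (f i) ⊤ volume) :
    MemLp (fun x => ∑ i, f i x) ⊤ volume := memLp_finsetSum _ fun i _ => hf i

theorem memLp_top_comp {F : Pt → Xi} (hF : ∀ A, MemLp (fun x => F x A) ⊤ volume) {g : Xi → ℝ}
    (hg : Continuous g) : MemLp (fun x => g (F x)) ⊤ volume := by
  have hF' : MemLp F ⊤ volume := memLp_pi_iff.2 hF
  choose C hC using fun A => exists_ae_bound (hF A)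
  obtain ⟨B, hB⟩ := (isCompact_closedBall (0 : Xi) (∑ A, |C A|)).exists_bound_of_continuousOn
    hg.continuousOn
  refine memLp_top_of_bound (hg.comp_aestronglyMeasurable hF'.1) B ?_
  filter_upwards [ae_all_iff.2 hC] with x hx
  refine hB _ ?_
  rw [mem_closedBall_zero_iff, pi_norm_le_iff_of_nonneg (Finset.sum_nonneg fun _ _ => abs_nonneg _)]
  exact fun A => (hx A).trans ((le_abs_self _).trans (Finset.single_le_sum (f := fun A => |C A|)
    (fun _ _ => abs_nonneg _) (Finset.mem_univ A)))

theorem integrableOn_unitCell (hf : MemLp f ⊤ volume) : IntegrableOn f unitCell := by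
  have : IsFiniteMeasure (volume.restrict unitCell) :=
    isFiniteMeasure_restrict.2 isCompact_unitCell.measure_lt_top.ne
  exact (hf.restrict unitCell).integrable le_top

end bounded

/-! ### The relative entropy along curves -/

theorem fderiv_apply_eq_sum (G : Xi → ℝ) (ξ b : Xi) : fderiv ℝ G ξ b = ∑ A, dG G A ξ * b A := by
  conv_lhs => rw [pi_eq_sum_univ' b]
  simp only [map_sum, map_smul, smul_eq_mul, dG, mul_comm]

theorem hasDerivAt_comp_sum {G : Xi → ℝ} (hG : Differentiable ℝ G) {q : ℝ → Xi} {q' : Xi} {t : ℝ}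
    (hq : HasDerivAt q q' t) :
    HasDerivAt (fun s => G (q s)) (∑ A, dG G A (q t) * q' A) t := by
  rw [← fderiv_apply_eq_sum]
  exact (hG (q t)).hasFDerivAt.comp_hasDerivAt t hq

theorem fderiv_entropy {G : Xi → ℝ} (hG : Differentiable ℝ G) (Θ δ : (Fin 3 → ℝ) × Xi) :
    fderiv ℝ (entropy G) Θ δ = ∑ i, Θ.1 i * δ.1 i + ∑ A, dG G A Θ.2 * δ.2 A := by
  have h1 : ∀ i, HasFDerivAt (fun Θ : (Fin 3 → ℝ) × Xi => Θ.1 i)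
      ((ContinuousLinearMap.proj (R := ℝ) (φ := fun _ : Fin 3 => ℝ) i).comp
        (ContinuousLinearMap.fst ℝ _ Xi)) Θ := fun i =>
    HasFDerivAt.comp Θ (ContinuousLinearMap.proj (R := ℝ) (φ := fun _ : Fin 3 => ℝ) i).hasFDerivAt
      (ContinuousLinearMap.fst ℝ (Fin 3 → ℝ) Xi).hasFDerivAt
  have h2 : HasFDerivAt (fun Θ : (Fin 3 → ℝ) × Xi => G Θ.2) _ Θ :=
    (hG Θ.2).hasFDerivAt.comp Θ (ContinuousLinearMap.snd ℝ (Fin 3 → ℝ) Xi).hasFDerivAt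
  have h3 := ((HasFDerivAt.fun_sum (u := Finset.univ) fun i _ => (h1 i).pow 2).mul_const
    (2⁻¹ : ℝ)).fun_add h2
  have h4 : HasFDerivAt (entropy G) _ Θ :=
    h3.congr_of_eventuallyEq (Eventually.of_forall fun Θ => by simp [entropy, div_eq_mul_inv])
  rw [h4.fderiv, ← fderiv_apply_eq_sum]
  simp [Finset.mul_sum]
  refine Finset.sum_congr rfl fun i _ => ?_
  ring

/-- The first-order terms in `p'` and `q'` from `-η(Θ)` and `-Dη(Θ)(-Θ)` cancel; the motion of the
base point enters only through the Hessian of `η`. -/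
theorem hasDerivAt_relEntropy {G : Xi → ℝ} (hG : ContDiff ℝ 2 G) {a p : ℝ → Fin 3 → ℝ}
    {b q : ℝ → Xi} {a' p' : Fin 3 → ℝ} {b' q' : Xi} {t : ℝ} (ha : HasDerivAt a a' t)
    (hb : HasDerivAt b b' t) (hp : HasDerivAt p p' t) (hq : HasDerivAt q q' t) :
    HasDerivAt (fun s => relEntropy G (a s, b s) (p s, q s))
      (∑ i, (a t i - p t i) * a' i - ∑ i, p' i * (a t i - p t i)
        + ∑ A, (dG G A (b t) - dG G A (q t)) * b' A
        - ∑ A, (∑ B, ddG G A B (q t) * q' B) * (b t A - q t A)) t := by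
  have hGd : Differentiable ℝ G := hG.differentiable two_ne_zero
  have hgd : ∀ A, Differentiable ℝ (dG G A) := fun A => (contDiff_dG hG A).differentiable one_ne_zero
  have ha := hasDerivAt_pi.1 ha
  have hp := hasDerivAt_pi.1 hp
  have hb' := hasDerivAt_pi.1 hb
  have hq' := hasDerivAt_pi.1 hq
  have h := ((((HasDerivAt.fun_sum (u := Finset.univ) fun i _ => (ha i).pow 2).div_const 2).fun_add
    (hasDerivAt_comp_sum hGd hb)).fun_sub
    (((HasDerivAt.fun_sum (u := Finset.univ) fun i _ => (hp i).pow 2).div_const 2).fun_add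
    (hasDerivAt_comp_sum hGd hq))).fun_sub
    ((HasDerivAt.fun_sum (u := Finset.univ) fun i _ => (hp i).fun_mul ((ha i).fun_sub (hp i))).fun_add
    (HasDerivAt.fun_sum (u := Finset.univ) fun A _ =>
      (hasDerivAt_comp_sum (hgd A) hq).fun_mul ((hb' A).fun_sub (hq' A))))
  refine (h.congr_of_eventuallyEq (Eventually.of_forall fun s => ?_)).congr_deriv ?_
  · simp [relEntropy, fderiv_entropy hGd, entropy]
  · simp only [Finset.sum_add_distrib, sub_mul, mul_sub, Finset.sum_sub_distrib, ddG,
      Finset.sum_div]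
    have e1 : ∀ x y : Fin 3 → ℝ, ∑ i, (2 : ℕ) * x i ^ (2 - 1) * y i / 2 = ∑ i, x i * y i :=
      fun x y => Finset.sum_congr rfl fun i _ => by simp; ring
    rw [e1, e1]
    ring

theorem ddG_symm {G : Xi → ℝ} (hG : ContDiff ℝ 2 G) (A B : Idx) (ξ : Xi) :
    ddG G A B ξ = ddG G B A ξ := by
  have hd : DifferentiableAt ℝ (fderiv ℝ G) ξ :=
    (hG.fderiv_right (m := 1) (by norm_num)).differentiable one_ne_zero ξ
  have key : ∀ A B, ddG G A B ξ = fderiv ℝ (fderiv ℝ G) ξ (Pi.single B 1) (Pi.single A 1) := by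
    intro A B
    have h : HasFDerivAt (dG G A) _ ξ := hd.hasFDerivAt.clm_apply (hasFDerivAt_const _ ξ)
    rw [ddG, dG, h.fderiv]
    simp
  rw [key, key]
  exact (hG.contDiffAt.isSymmSndFDerivAt (by simp)) _ _

theorem continuous_ddG {G : Xi → ℝ} (hG : ContDiff ℝ 2 G) (A B : Idx) : Continuous (ddG G A B) :=
  ((contDiff_dG hG A).continuous_fderiv one_ne_zero).clm_apply continuous_const

/-! ### The interpolants -/

/-- Only the countably many grid times `nτ` are excluded, where the interpolant may have a kink. -/
theorem ae_stepIdx_eventuallyEq {τ : ℝ} (hτ : 0 < τ) :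
    ∀ᵐ t : ℝ, 0 < t → ∀ᶠ s in 𝓝 t, stepIdx τ s = stepIdx τ t := by
  have hc : (range fun n : ℕ => (n : ℝ) * τ).Countable := countable_range _
  filter_upwards [hc.ae_notMem volume] with t ht ht0
  have h0 : 0 ≤ t / τ := (div_pos ht0 hτ).le
  have h1 : (stepIdx τ t : ℝ) < t / τ := by
    refine lt_of_le_of_ne (Nat.floor_le h0) fun h => ht ⟨stepIdx τ t, ?_⟩
    change (stepIdx τ t : ℝ) * τ = t
    rw [h, div_mul_cancel₀ _ hτ.ne']
  have h2 : t / τ < stepIdx τ t + 1 := Nat.lt_floor_add_one _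
  have hcont : Tendsto (fun s : ℝ => s / τ) (𝓝 t) (𝓝 (t / τ)) := (continuous_id.div_const τ).tendsto t
  filter_upwards [hcont.eventually (Ioo_mem_nhds h1 h2)] with s hs
  exact (Nat.floor_eq_iff ((Nat.cast_nonneg _).trans hs.1.le)).2 ⟨hs.1.le, hs.2⟩

theorem hasDerivAt_hatInterp {β : Type*} [Fintype β] {τ t : ℝ} (f : ℕ → Pt → β → ℝ)
    (ht : ∀ᶠ s in 𝓝 t, stepIdx τ s = stepIdx τ t) (x : Pt) :
    HasDerivAt (fun s => hatInterp τ f s x) (fun b => increment τ f t x b / τ) t := by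
  refine hasDerivAt_pi.2 fun b => ?_
  have h := ((((hasDerivAt_id t).sub_const (τ * stepIdx τ t)).div_const τ).mul_const
    (increment τ f t x b)).const_add (f (stepIdx τ t) x b)
  refine (h.congr_of_eventuallyEq ?_).congr_deriv (by ring)
  filter_upwards [ht] with s hs
  simp [hatInterp, hs, increment]

/-! ### Algebraic form of the identity -/

theorem sum_rotate {ι κ μ : Type*} [Fintype ι] [Fintype κ] [Fintype μ] (f : μ → ι → κ → ℝ) :
    ∑ i, ∑ α, ∑ A, f A i α = ∑ A, ∑ i, ∑ α, f A i α := by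
  simp only [Finset.sum_comm (s := (Finset.univ : Finset κ))]
  exact Finset.sum_comm

/-- The pointwise identity behind the relative entropy identity: the time derivative of the relative
entropy differs from the right hand side by four terms of integral zero. -/
theorem relEntropy_algebra {ι κ μ : Type*} [Fintype ι] [Fintype κ] [Fintype μ]
    (τ : ℝ) (vb vh v Pv dv vt : ι → ℝ) (gb gh g dX w ξt : μ → ℝ) (H : μ → μ → ℝ)
    (a : μ → κ → ℝ) (Ps Ph P : μ → ι → κ → ℝ) (Dvb DPv Dv : ι → κ → ℝ)
    (hH : ∀ A B, H A B = H B A)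
    (hX : ∀ A, dX A / τ = ∑ i, ∑ α, Ps A i α * Dvb i α)
    (hv : ∀ i, vt i = ∑ A, ∑ α, a A α * P A i α)
    (hξ : ∀ A, ξt A = ∑ i, ∑ α, P A i α * Dv i α) :
    (∑ i, (vh i - v i) * (dv i / τ) - ∑ i, vt i * (vh i - v i)
        + ∑ A, (gh A - g A) * (dX A / τ) - ∑ A, (∑ B, H A B * ξt B) * w A) =
    (-(1 / τ) * (∑ i, (vb i - vh i) * dv i + ∑ A, (gb A - gh A) * dX A)
      + (∑ A, ∑ i, ∑ α, (a A α * (Ph A i α - P A i α) * (vh i - v i)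
          + Dv i α * (gh A - g A) * (Ph A i α - P A i α)
          + Dv i α * (gh A - g A - ∑ B, H A B * w B) * P A i α))
      + (∑ A, ∑ i, ∑ α, (a A α * (P A i α * (vb i - vh i)
            + (Ph A i α - P A i α) * (vb i - vh i)
            + (Ps A i α - Ph A i α) * (vb i - vh i)
            + (Ps A i α - Ph A i α) * (vh i - v i))
          + Dv i α * ((gb A - gh A) * P A i α + (gb A - gh A) * (Ps A i α - Ph A i α)
            + (gb A - gh A) * (Ph A i α - P A i α) + (gh A - g A) * (Ps A i α - Ph A i α))))
      + (∑ A, ∑ i, ∑ α, gb A * Ps A i α * (DPv i α - Dv i α)))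
    + (∑ i, dv i / τ * vb i + ∑ A, ∑ i, ∑ α, gb A * Ps A i α * Dvb i α)
    + (-(1 / τ)) * (∑ i, (v i - Pv i) * dv i)
    - (∑ i, dv i / τ * Pv i + ∑ A, ∑ i, ∑ α, gb A * Ps A i α * DPv i α)
    - ∑ A, ∑ i, ∑ α, Ps A i α * (a A α * (vb i - v i) + g A * (Dvb i α - Dv i α)) := by
  have e1 : ∀ y : μ → ℝ, ∑ A, y A * (dX A / τ) = ∑ A, ∑ i, ∑ α, y A * (Ps A i α * Dvb i α) := by
    intro y
    simp only [hX, Finset.mul_sum]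
  have e2 : ∑ i, vt i * (vh i - v i) = ∑ A, ∑ i, ∑ α, a A α * P A i α * (vh i - v i) := by
    simp only [hv, Finset.sum_mul]
    exact Finset.sum_comm
  -- Symmetry of the Hessian transfers it from `∂_t ξ` to `ξ̂ - ξ`, the form in which it occurs in
  -- `Q`.
  have e3 : ∑ A, (∑ B, H A B * ξt B) * w A =
      ∑ A, ∑ i, ∑ α, (∑ B, H A B * w B) * (P A i α * Dv i α) := by
    have : ∀ A, ∑ i, ∑ α, (∑ B, H A B * w B) * (P A i α * Dv i α) = (∑ B, H A B * w B) * ξt A := by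
      intro A
      simp only [hξ, Finset.mul_sum]
    rw [Finset.sum_congr rfl fun A _ => this A]
    simp only [Finset.sum_mul]
    rw [Finset.sum_comm]
    refine Finset.sum_congr rfl fun A _ => Finset.sum_congr rfl fun B _ => ?_
    rw [hH B A]; ring
  have e4 : -(1 / τ) * (∑ i, (vb i - vh i) * dv i + ∑ A, (gb A - gh A) * dX A) =
      -(∑ i, (vb i - vh i) * (dv i / τ)) - ∑ A, (gb A - gh A) * (dX A / τ) := by
    rw [mul_add, Finset.mul_sum, Finset.mul_sum, ← Finset.sum_neg_distrib, sub_eq_add_neg,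
      ← Finset.sum_neg_distrib]
    congr 1 <;> exact Finset.sum_congr rfl fun _ _ => by ring
  have e5 : (-(1 / τ)) * (∑ i, (v i - Pv i) * dv i) = -∑ i, (v i - Pv i) * (dv i / τ) := by
    rw [Finset.mul_sum, ← Finset.sum_neg_distrib]
    exact Finset.sum_congr rfl fun _ _ => by ring
  -- The splitting `v̂ - v = -(v̄ - v̂) + v̄ - (v - ℙv) - ℙv` yields, in order, a part of the
  -- dissipation, the test with `v̄`, the projection error and the test with `ℙv`.
  have e6 : ∑ i, (vh i - v i) * (dv i / τ) = -(∑ i, (vb i - vh i) * (dv i / τ))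
      + ∑ i, dv i / τ * vb i - ∑ i, (v i - Pv i) * (dv i / τ) - ∑ i, dv i / τ * Pv i := by
    simp only [← Finset.sum_neg_distrib, ← Finset.sum_add_distrib, ← Finset.sum_sub_distrib]
    exact Finset.sum_congr rfl fun _ _ => by ring
  rw [e1, e2, e3, e4, e5, e6, e1]
  -- The rest holds separately for each triple `(A, i, α)`.
  have e7 : -(∑ A, ∑ i, ∑ α, a A α * P A i α * (vh i - v i))
      + ∑ A, ∑ i, ∑ α, (gh A - g A) * (Ps A i α * Dvb i α)
      - ∑ A, ∑ i, ∑ α, (∑ B, H A B * w B) * (P A i α * Dv i α) =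
    -(∑ A, ∑ i, ∑ α, (gb A - gh A) * (Ps A i α * Dvb i α))
      + (∑ A, ∑ i, ∑ α, (a A α * (Ph A i α - P A i α) * (vh i - v i)
          + Dv i α * (gh A - g A) * (Ph A i α - P A i α)
          + Dv i α * (gh A - g A - ∑ B, H A B * w B) * P A i α))
      + (∑ A, ∑ i, ∑ α, (a A α * (P A i α * (vb i - vh i)
            + (Ph A i α - P A i α) * (vb i - vh i)
            + (Ps A i α - Ph A i α) * (vb i - vh i)
            + (Ps A i α - Ph A i α) * (vh i - v i))
          + Dv i α * ((gb A - gh A) * P A i α + (gb A - gh A) * (Ps A i α - Ph A i α)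
            + (gb A - gh A) * (Ph A i α - P A i α) + (gh A - g A) * (Ps A i α - Ph A i α))))
      + (∑ A, ∑ i, ∑ α, gb A * Ps A i α * (DPv i α - Dv i α))
      + (∑ A, ∑ i, ∑ α, gb A * Ps A i α * Dvb i α)
      - (∑ A, ∑ i, ∑ α, gb A * Ps A i α * DPv i α)
      - ∑ A, ∑ i, ∑ α, Ps A i α * (a A α * (vb i - v i) + g A * (Dvb i α - Dv i α)) := by
    simp only [← Finset.sum_neg_distrib, ← Finset.sum_add_distrib, ← Finset.sum_sub_distrib]
    exact Finset.sum_congr rfl fun A _ => Finset.sum_congr rfl fun i _ =>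
      Finset.sum_congr rfl fun α _ => by ring
  linear_combination e7


/-! ### Bounds and vanishing integrals for the discrete solution. -/

theorem termD_eq {G : Xi → ℝ} (hG : Differentiable ℝ G) (Θb Θh δ : (Fin 3 → ℝ) × Xi) :
    termD G Θb Θh δ = ∑ i, (Θb.1 i - Θh.1 i) * δ.1 i
      + ∑ A, (dG G A Θb.2 - dG G A Θh.2) * δ.2 A := by
  rw [termD, sub_apply, fderiv_entropy hG, fderiv_entropy hG]
  simp only [sub_mul, Finset.sum_sub_distrib]
  ring

theorem continuous_dPhi_Fpart (A : Idx) (i α : Fin 3) :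
    Continuous (fun ξ : Xi => dPhi A i α (Fpart ξ)) :=
  (contDiff_dPhi A i α).continuous.comp
    (continuous_pi fun i => continuous_pi fun α => continuous_apply (Sum.inl (i, α)))

namespace IsDiscreteSolution

variable {G : Xi → ℝ} {M : PeriodicMesh} {k : ℕ} {τ : ℝ} {V : ℕ → Pt → Fin 3 → ℝ}
  {X : ℕ → Pt → Xi}

/-- The `F`-component of the kinematic equation reads `F^{n+1} = F^n + τ ∇v^{n+1}` a.e., and
`v^{n+1}` is Lipschitz. -/
theorem weakCurlFree (h : IsDiscreteSolution G M k τ V X) (hτ : τ ≠ 0)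
    (h0 : IsGradient (fun x => Fpart (X 0 x))) (n : ℕ) :
    WeakCurlFree (fun x => Fpart (X n x)) := by
  induction n with
  | zero => exact h0.weakCurlFree
  | succ n ih =>
    refine ih.add_grad (fun i α => Hh_memLp (h.mem_H n) (Sum.inl (i, α)))
      (fun i => Uh_torusLip (h.mem_U (n + 1)) i) (τ := τ) fun j β => ?_
    filter_upwards [h.kinematic_ae n (Sum.inl (j, β))] with x hx
    have : ∑ i, ∑ α, dPhi (Sum.inl (j, β)) i α (Fpart (X n x)) * pd α (fun y => V (n + 1) y i) x =
        pd β (fun y => V (n + 1) y j) x := by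
      simp [dPhi_F, ite_and]
    rw [this, div_eq_iff hτ] at hx
    simp only [Fpart]
    linarith

theorem memLp_dG (h : IsDiscreteSolution G M k τ V X) (hG : ContDiff ℝ 2 G) (n : ℕ) (A : Idx) :
    MemLp (fun x => dG G A (X n x)) ⊤ volume :=
  memLp_top_comp (Hh_memLp (h.mem_H n)) (contDiff_dG hG A).continuous

theorem memLp_dPhi (h : IsDiscreteSolution G M k τ V X) (n : ℕ) (A : Idx) (i α : Fin 3) :
    MemLp (fun x => dPhi A i α (Fpart (X n x))) ⊤ volume :=
  memLp_top_comp (Hh_memLp (h.mem_H n)) (continuous_dPhi_Fpart A i α)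

theorem memLp_momentum_left (h : IsDiscreteSolution G M k τ V X) (n : ℕ) {φ : Pt → Fin 3 → ℝ}
    (hφ : φ ∈ Uh M k) :
    MemLp (fun x => ∑ i, (V (n + 1) x i - V n x i) / τ * φ x i) ⊤ volume := by
  have hV := fun n i => (Uh_torusLip (h.mem_U n) i).memLp_top
  simp only [div_eq_mul_inv]
  exact memLp_top_sum fun i => memLp_top_mul
    (memLp_top_mul (memLp_top_sub (hV _ i) (hV _ i)) (memLp_top_const _))
    (Uh_torusLip hφ i).memLp_top

theorem memLp_momentum_right (h : IsDiscreteSolution G M k τ V X) (hG : ContDiff ℝ 2 G) (n : ℕ)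
    {φ : Pt → Fin 3 → ℝ} (hφ : φ ∈ Uh M k) :
    MemLp (fun x => ∑ A, ∑ i, ∑ α, dG G A (X (n + 1) x) * dPhi A i α (Fpart (X n x))
      * pd α (fun y => φ y i) x) ⊤ volume :=
  memLp_top_sum fun A => memLp_top_sum fun i => memLp_top_sum fun α =>
    memLp_top_mul (memLp_top_mul (h.memLp_dG hG _ A) (h.memLp_dPhi n A i α))
      ((Uh_torusLip hφ i).memLp_pd α)

theorem setIntegral_momentum (h : IsDiscreteSolution G M k τ V X) (hG : ContDiff ℝ 2 G) (n : ℕ)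
    {φ : Pt → Fin 3 → ℝ} (hφ : φ ∈ Uh M k) :
    ∫ x in unitCell, (∑ i, (V (n + 1) x i - V n x i) / τ * φ x i +
      ∑ A, ∑ i, ∑ α, dG G A (X (n + 1) x) * dPhi A i α (Fpart (X n x))
        * pd α (fun y => φ y i) x) = 0 := by
  rw [integral_add (integrableOn_unitCell (h.memLp_momentum_left n hφ))
    (integrableOn_unitCell (h.memLp_momentum_right hG n hφ)), h.momentum n φ hφ]
  simp only [sum_rotate (fun A i α => dG G A (X (n + 1) _) * dPhi A i α (Fpart (X n _)) *
    pd α (fun y => φ y i) _)]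
  exact neg_add_cancel _

theorem ae_pd_mul_sub (h : IsDiscreteSolution G M k τ V X) (n : ℕ) {g : Pt → ℝ} (hg : TorusLip g)
    {v : Pt → Fin 3 → ℝ} (hv : ∀ i, TorusLip (fun x => v x i)) :
    ∀ᵐ x, ∀ i α, pd α (fun y => g y * (V n y i - v y i)) x =
      pd α g x * (V n x i - v x i) +
        g x * (pd α (fun y => V n y i) x - pd α (fun y => v y i) x) := by
  filter_upwards [hg.ae_differentiableAt,
    ae_all_iff.2 fun i => (Uh_torusLip (h.mem_U n) i).ae_differentiableAt,
    ae_all_iff.2 fun i => (hv i).ae_differentiableAt] with x h1 h2 h3 i α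
  rw [pd_mul h1 ((h2 i).fun_sub (h3 i)), pd_sub (h2 i) (h3 i)]

theorem memLp_nullLagrangian (h : IsDiscreteSolution G M k τ V X) (n : ℕ) {g : Idx → Pt → ℝ}
    (hg : ∀ A, TorusLip (g A)) {v : Pt → Fin 3 → ℝ} (hv : ∀ i, TorusLip (fun x => v x i)) :
    MemLp (fun x => ∑ A, ∑ i, ∑ α, dPhi A i α (Fpart (X n x)) *
      (pd α (g A) x * (V (n + 1) x i - v x i) +
        g A x * (pd α (fun y => V (n + 1) y i) x - pd α (fun y => v y i) x))) ⊤ volume :=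
  memLp_top_sum fun A => memLp_top_sum fun i => memLp_top_sum fun α =>
    memLp_top_mul (h.memLp_dPhi n A i α) (memLp_top_add
      (memLp_top_mul ((hg A).memLp_pd α) (memLp_top_sub
        (Uh_torusLip (h.mem_U (n + 1)) i).memLp_top (hv i).memLp_top))
      (memLp_top_mul (hg A).memLp_top (memLp_top_sub
        ((Uh_torusLip (h.mem_U (n + 1)) i).memLp_pd α) ((hv i).memLp_pd α))))

/-- The bracket is a.e. `∂_α(g_A (v^{n+1} - v)_i)`, so the weak null Lagrangian identity applies for
each `A` and `i` with this Lipschitz test function. -/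
theorem setIntegral_nullLagrangian (h : IsDiscreteSolution G M k τ V X) (hτ : τ ≠ 0)
    (h0 : IsGradient (fun x => Fpart (X 0 x))) (n : ℕ) {g : Idx → Pt → ℝ}
    (hg : ∀ A, TorusLip (g A)) {v : Pt → Fin 3 → ℝ} (hv : ∀ i, TorusLip (fun x => v x i)) :
    ∫ x in unitCell, ∑ A, ∑ i, ∑ α, dPhi A i α (Fpart (X n x)) *
      (pd α (g A) x * (V (n + 1) x i - v x i) +
        g A x * (pd α (fun y => V (n + 1) y i) x - pd α (fun y => v y i) x)) = 0 := by
  have hψ : ∀ A i, TorusLip (fun y => g A y * (V (n + 1) y i - v y i)) := fun A i =>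
    (hg A).mul ((Uh_torusLip (h.mem_U (n + 1)) i).sub (hv i))
  have h1 : ∀ A i, ∫ x in unitCell, ∑ α, dPhi A i α (Fpart (X n x)) *
      pd α (fun y => g A y * (V (n + 1) y i - v y i)) x = 0 := fun A i =>
    (h.weakCurlFree hτ h0 n).setIntegral_dPhi_mul_pd ((h.mem_H n).1.comp Fpart)
      (fun i α => Hh_memLp (h.mem_H n) (Sum.inl (i, α))) (hψ A i) A i
  have h2 : ∀ A i, MemLp (fun x => ∑ α, dPhi A i α (Fpart (X n x)) *
      pd α (fun y => g A y * (V (n + 1) y i - v y i)) x) ⊤ volume := fun A i =>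
    memLp_top_sum fun α => memLp_top_mul (h.memLp_dPhi n A i α) ((hψ A i).memLp_pd α)
  have h3 : ∫ x in unitCell, ∑ A, ∑ i, ∑ α, dPhi A i α (Fpart (X n x)) *
      pd α (fun y => g A y * (V (n + 1) y i - v y i)) x = 0 := by
    rw [integral_finsetSum _ fun A _ => integrableOn_unitCell (memLp_top_sum fun i => h2 A i)]
    refine Finset.sum_eq_zero fun A _ => ?_
    rw [integral_finsetSum _ fun i _ => integrableOn_unitCell (h2 A i)]
    exact Finset.sum_eq_zero fun i _ => h1 A i
  rw [← h3]
  refine setIntegral_congr_ae measurableSet_unitCell ?_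
  filter_upwards [ae_all_iff.2 fun A => h.ae_pd_mul_sub (n + 1) (hg A) hv] with x hx _
  simp only [hx]

end IsDiscreteSolution

end Elasto

/-! ### The relative entropy identity. -/

theorem mainTheorem2 (G : Xi → ℝ) (hG : ContDiff ℝ 2 G)
    (M : PeriodicMesh) (k : ℕ) (hk : 1 ≤ k) (τ : ℝ) (hτ : 0 < τ)
    (V : ℕ → Pt → Fin 3 → ℝ) (X : ℕ → Pt → Xi) (hVX : IsDiscreteSolution G M k τ V X)
    (hX0 : IsGradient (fun x => Fpart (X 0 x)))
    (T : ℝ) (hT : 0 < T) (v : ℝ → Pt → Fin 3 → ℝ) (ξ : ℝ → Pt → Xi)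
    (hsol : IsSmoothSolution G T v ξ) (hξ0 : IsGradient (fun x => Fpart (ξ 0 x))) :
    let vh := hatInterp τ V
    let ξh := hatInterp τ X
    let vb := barInterp τ V
    let ξb := barInterp τ X
    let Fs := shiftInterp τ (fun n x => Fpart (X n x))
    let ηr : ℝ → Pt → ℝ := fun t x => relEntropy G (vh t x, ξh t x) (v t x, ξ t x)
    let D : ℝ → Pt → ℝ := fun t x =>
      termD G (vb t x, ξb t x) (vh t x, ξh t x) (increment τ V t x, increment τ X t x)
    let Q : ℝ → Pt → ℝ := fun t x => termQ G (vh t x) (ξh t x) (v t) (ξ t) x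
    let E : ℝ → Pt → ℝ := fun t x =>
      termE G (vb t x) (ξb t x) (Fs t x) (vh t x) (ξh t x) (v t) (ξ t) x
    let Eb : ℝ → Pt → ℝ := fun t x => termEbar G M k (ξb t x) (Fs t x) (v t) x
    ∀ᵐ t ∂(volume.restrict (Icc 0 T)),
      (∀ x, DifferentiableAt ℝ (fun s => ηr s x) t) ∧
      IntegrableOn (fun x => deriv (fun s => ηr s x) t) unitCell ∧
      IntegrableOn
        (fun x => -(1 / τ) * D t x + Q t x + E t x + Eb t x) unitCell ∧
      ∫ x in unitCell, deriv (fun s => ηr s x) t =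
        ∫ x in unitCell, (-(1 / τ) * D t x + Q t x + E t x + Eb t x) := by
  intro vh ξh vb ξb Fs ηr D Q E Eb
  have hIoo : ∀ᵐ t ∂(volume.restrict (Icc 0 T)), t ∈ Ioo 0 T := by
    rw [← Measure.restrict_congr_set Ioo_ae_eq_Icc]
    exact ae_restrict_mem measurableSet_Ioo
  filter_upwards [hIoo, ae_restrict_of_ae (ae_stepIdx_eventuallyEq hτ)] with t ht hstep'
  have hstep := hstep' ht.1
  have ht' : t ∈ Icc 0 T := Ioo_subset_Icc_self ht
  set n := stepIdx τ t
  have hGd : Differentiable ℝ G := hG.differentiable two_ne_zero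
  have hVL := fun n i => Uh_torusLip (hVX.mem_U n) i
  have hvL := fun i => hsol.torusLip_v ht' i
  have hgL : ∀ A, TorusLip (fun x => dG G A (ξ t x)) := fun A =>
    TorusLip.of_contDiff ((hsol.periodic_ξ t ht').comp _)
      ((contDiff_dG hG A).comp (hsol.contDiff_ξ ht'))
  have hproj : IsL2Proj M k (v t) (projU M k (v t)) := isL2Proj_projU M k fun i =>
    integrableOn_unitCell (hvL i).memLp_top
  have hPL := fun i => Uh_torusLip hproj.1 i
  set P := projU M k (v t)
  -- the time derivative
  have hder : ∀ x, HasDerivAt (fun s => ηr s x) _ t := fun x =>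
    hasDerivAt_relEntropy hG (hasDerivAt_hatInterp V hstep x) (hasDerivAt_hatInterp X hstep x)
      (hsol.hasDerivAt_v ht x) (hsol.hasDerivAt_ξ ht x)
  have hvt : ∀ x i, fderiv ℝ (fun p : ℝ × Pt => v p.1 p.2) (t, x) (1, 0) i =
      ∑ A, ∑ α, pd α (fun y => dG G A (ξ t y)) x * dPhi A i α (Fpart (ξ t x)) := fun x i => by
    rw [← hsol.momentum_eq hG hξ0 ht, (hasDerivAt_pi.1 (hsol.hasDerivAt_v ht x) i).deriv]
  have hξt : ∀ x A, fderiv ℝ (fun p : ℝ × Pt => ξ p.1 p.2) (t, x) (1, 0) A =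
      ∑ i, ∑ α, dPhi A i α (Fpart (ξ t x)) * pd α (fun y => v t y i) x := fun x A => by
    rw [← hsol.kinematic_eq hξ0 ht, (hasDerivAt_pi.1 (hsol.hasDerivAt_ξ ht x) A).deriv]
  -- the terms with vanishing integral
  set S1 : Pt → ℝ := fun x => ∑ i, (V (n + 1) x i - V n x i) / τ * V (n + 1) x i +
      ∑ A, ∑ i, ∑ α, dG G A (X (n + 1) x) * dPhi A i α (Fpart (X n x))
        * pd α (fun y => V (n + 1) y i) x
  set S2 : Pt → ℝ := fun x => ∑ i, (v t x i - P x i) * (V (n + 1) x i - V n x i)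
  set S3 : Pt → ℝ := fun x => ∑ i, (V (n + 1) x i - V n x i) / τ * P x i +
      ∑ A, ∑ i, ∑ α, dG G A (X (n + 1) x) * dPhi A i α (Fpart (X n x)) * pd α (fun y => P y i) x
  set S4 : Pt → ℝ := fun x => ∑ A, ∑ i, ∑ α, dPhi A i α (Fpart (X n x)) *
      (pd α (fun y => dG G A (ξ t y)) x * (V (n + 1) x i - v t x i) +
        dG G A (ξ t x) * (pd α (fun y => V (n + 1) y i) x - pd α (fun y => v t y i) x))
  set R : Pt → ℝ := fun x => -(1 / τ) * D t x + Q t x + E t x + Eb t x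
  -- Only for a.e. `x`: the discrete kinematic equation holds a.e., and `∂_α(ℙ^U v - v)` splits only
  -- where `ℙ^U v` is differentiable.
  have hkey : ∀ᵐ x, deriv (fun s => ηr s x) t = R x + S1 x + -(1 / τ) * S2 x - S3 x - S4 x := by
    filter_upwards [ae_all_iff.2 fun A => hVX.kinematic_ae n A,
      ae_all_iff.2 fun i => (hPL i).ae_differentiableAt,
      ae_all_iff.2 fun i => (hvL i).ae_differentiableAt] with x hx hPd hvd
    have hEb : Eb t x = ∑ A, ∑ i, ∑ α, dG G A (X (n + 1) x) * dPhi A i α (Fpart (X n x)) *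
        (pd α (fun y => P y i) x - pd α (fun y => v t y i) x) := by
      simp only [← fun i => pd_sub (hPd i) (hvd i)]
      rfl
    have hD : D t x = _ := termD_eq hGd _ _ _
    rw [(hder x).deriv]
    simp only [R, hEb, hD]
    exact relEntropy_algebra τ (V (n + 1) x) (vh t x) (v t x) (P x) (increment τ V t x) _
      (fun A => dG G A (X (n + 1) x)) (fun A => dG G A (ξh t x)) (fun A => dG G A (ξ t x))
      (increment τ X t x) (fun A => ξh t x A - ξ t x A) _ (fun A B => ddG G A B (ξ t x))
      (fun A α => pd α (fun y => dG G A (ξ t y)) x) (fun A i α => dPhi A i α (Fpart (X n x)))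
      (fun A i α => dPhi A i α (Fpart (ξh t x))) (fun A i α => dPhi A i α (Fpart (ξ t x)))
      (fun i α => pd α (fun y => V (n + 1) y i) x) (fun i α => pd α (fun y => P y i) x)
      (fun i α => pd α (fun y => v t y i) x) (fun A B => ddG_symm hG A B _) hx (hvt x) (hξt x)
  have hS1 : MemLp S1 ⊤ volume := memLp_top_add (hVX.memLp_momentum_left n (hVX.mem_U (n + 1)))
    (hVX.memLp_momentum_right hG n (hVX.mem_U (n + 1)))
  have hS3 : MemLp S3 ⊤ volume := memLp_top_add (hVX.memLp_momentum_left n hproj.1)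
    (hVX.memLp_momentum_right hG n hproj.1)
  have hS2 : MemLp S2 ⊤ volume := memLp_top_sum fun i => memLp_top_mul
    (memLp_top_sub (hvL i).memLp_top (hPL i).memLp_top)
    (memLp_top_sub (hVL _ i).memLp_top (hVL _ i).memLp_top)
  have hS4 : MemLp S4 ⊤ volume := hVX.memLp_nullLagrangian n hgL hvL
  have hI1 : ∫ x in unitCell, S1 x = 0 := hVX.setIntegral_momentum hG n (hVX.mem_U (n + 1))
  have hI2 : ∫ x in unitCell, S2 x = 0 :=
    hproj.2 _ ((Uh M k).sub_mem (hVX.mem_U (n + 1)) (hVX.mem_U n))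
  have hI3 : ∫ x in unitCell, S3 x = 0 := hVX.setIntegral_momentum hG n hproj.1
  have hI4 : ∫ x in unitCell, S4 x = 0 := hVX.setIntegral_nullLagrangian hτ.ne' hX0 n hgL hvL
  -- the right hand side is essentially bounded
  have hR : MemLp R ⊤ volume := by
    have bV := fun n i => (hVL n i).memLp_top
    have bX := fun n A => Hh_memLp (hVX.mem_H n) A
    have bv := fun i => (hvL i).memLp_top
    have bξ := fun A => (hsol.torusLip_ξ ht' A).memLp_top
    have bvh : ∀ i, MemLp (fun x => vh t x i) ⊤ volume := fun i => memLp_top_add (bV n i)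
      (memLp_top_mul (memLp_top_const _) (memLp_top_sub (bV (n + 1) i) (bV n i)))
    have bξh : ∀ A, MemLp (fun x => ξh t x A) ⊤ volume := fun A => memLp_top_add (bX n A)
      (memLp_top_mul (memLp_top_const _) (memLp_top_sub (bX (n + 1) A) (bX n A)))
    have bvb : ∀ i, MemLp (fun x => vb t x i) ⊤ volume := bV (n + 1)
    have bdV : ∀ i, MemLp (fun x => increment τ V t x i) ⊤ volume := fun i =>
      memLp_top_sub (bV (n + 1) i) (bV n i)
    have bdX : ∀ A, MemLp (fun x => increment τ X t x A) ⊤ volume := fun A =>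
      memLp_top_sub (bX (n + 1) A) (bX n A)
    have bgb : ∀ A, MemLp (fun x => dG G A (ξb t x)) ⊤ volume := hVX.memLp_dG hG (n + 1)
    have bgh : ∀ A, MemLp (fun x => dG G A (ξh t x)) ⊤ volume := fun A =>
      memLp_top_comp bξh (contDiff_dG hG A).continuous
    have bg : ∀ A, MemLp (fun x => dG G A (ξ t x)) ⊤ volume := fun A => (hgL A).memLp_top
    have bH : ∀ A B, MemLp (fun x => ddG G A B (ξ t x)) ⊤ volume := fun A B =>
      memLp_top_comp bξ (continuous_ddG hG A B)
    have bΦs : ∀ A i α, MemLp (fun x => dPhi A i α (Fs t x)) ⊤ volume := hVX.memLp_dPhi n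
    have bΦh : ∀ A i α, MemLp (fun x => dPhi A i α (Fpart (ξh t x))) ⊤ volume := fun A i α =>
      memLp_top_comp bξh (continuous_dPhi_Fpart A i α)
    have bΦ : ∀ A i α, MemLp (fun x => dPhi A i α (Fpart (ξ t x))) ⊤ volume := fun A i α =>
      memLp_top_comp bξ (continuous_dPhi_Fpart A i α)
    have ba : ∀ A α, MemLp (fun x => pd α (fun y => dG G A (ξ t y)) x) ⊤ volume := fun A α =>
      (hgL A).memLp_pd α
    have bDv : ∀ i α, MemLp (fun x => pd α (fun y => v t y i) x) ⊤ volume := fun i α =>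
      (hvL i).memLp_pd α
    have bDP : ∀ i α, MemLp (fun x => pd α (fun y => P y i - v t y i) x) ⊤ volume := fun i α =>
      ((hPL i).sub (hvL i)).memLp_pd α
    refine memLp_top_add (memLp_top_add (memLp_top_add
      (memLp_top_mul (memLp_top_const _) ?_) ?_) ?_) ?_
    · simp only [D, termD_eq hGd]
      exact memLp_top_add
        (memLp_top_sum fun i => memLp_top_mul (memLp_top_sub (bvb i) (bvh i)) (bdV i))
        (memLp_top_sum fun A => memLp_top_mul (memLp_top_sub (bgb A) (bgh A)) (bdX A))
    · refine memLp_top_sum fun A => memLp_top_sum fun i => memLp_top_sum fun α => ?_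
      have d1 := memLp_top_sub (bΦh A i α) (bΦ A i α)
      have d2 := memLp_top_sub (bgh A) (bg A)
      exact memLp_top_add (memLp_top_add
        (memLp_top_mul (memLp_top_mul (ba A α) d1) (memLp_top_sub (bvh i) (bv i)))
        (memLp_top_mul (memLp_top_mul (bDv i α) d2) d1))
        (memLp_top_mul (memLp_top_mul (bDv i α) (memLp_top_sub d2 (memLp_top_sum fun B =>
          memLp_top_mul (bH A B) (memLp_top_sub (bξh B) (bξ B))))) (bΦ A i α))
    · refine memLp_top_sum fun A => memLp_top_sum fun i => memLp_top_sum fun α => ?_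
      have d1 := memLp_top_sub (bΦh A i α) (bΦ A i α)
      have d2 := memLp_top_sub (bΦs A i α) (bΦh A i α)
      have d3 := memLp_top_sub (bvb i) (bvh i)
      have d4 := memLp_top_sub (bgb A) (bgh A)
      exact memLp_top_add
        (memLp_top_mul (ba A α) (memLp_top_add (memLp_top_add (memLp_top_add
          (memLp_top_mul (bΦ A i α) d3) (memLp_top_mul d1 d3)) (memLp_top_mul d2 d3))
          (memLp_top_mul d2 (memLp_top_sub (bvh i) (bv i)))))
        (memLp_top_mul (bDv i α) (memLp_top_add (memLp_top_add (memLp_top_add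
          (memLp_top_mul d4 (bΦ A i α)) (memLp_top_mul d4 d2)) (memLp_top_mul d4 d1))
          (memLp_top_mul (memLp_top_sub (bgh A) (bg A)) d2)))
    · exact memLp_top_sum fun A => memLp_top_sum fun i => memLp_top_sum fun α =>
        memLp_top_mul (memLp_top_mul (bgb A) (bΦs A i α)) (bDP i α)
  have hS2' : MemLp (fun x => -(1 / τ) * S2 x) ⊤ volume := memLp_top_mul (memLp_top_const _) hS2
  have h1 := memLp_top_add hR hS1
  have h2 := memLp_top_add h1 hS2'
  have h3 := memLp_top_sub h2 hS3
  have h4 := memLp_top_sub h3 hS4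
  have hkey' := hkey.mono fun x hx (_ : x ∈ unitCell) => hx
  refine ⟨fun x => (hder x).differentiableAt, ?_, integrableOn_unitCell hR, ?_⟩
  -- Integrability of the time derivative is read off from its a.e. expression by essentially
  -- bounded functions.
  · exact (integrableOn_unitCell h4).congr (ae_restrict_of_ae (hkey.mono fun x hx => hx.symm))
  · rw [setIntegral_congr_ae measurableSet_unitCell hkey',
      integral_sub (integrableOn_unitCell h3) (integrableOn_unitCell hS4),
      integral_sub (integrableOn_unitCell h2) (integrableOn_unitCell hS3),
      integral_add (integrableOn_unitCell h1) (integrableOn_unitCell hS2'),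
      integral_add (integrableOn_unitCell hR) (integrableOn_unitCell hS1),
      integral_const_mul, hI1, hI2, hI3, hI4]
    ring
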